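/- For real $a,c$ put $L_n(a,c)=\exp\left(c(\log n)^a(\log\log n)^{1-a}\right)$. Fix real numbers $\delta,\kappa>0$. Let $d(n)$ be positive integers with $d(n)=(\delta+o(1))\left(\frac{\log n}{\log\log n}\right)^{1/3}$ as $n\to\infty$. Let $f\in\mathbb{Z}[x]$ be irreducible of degree $d(n)$ with all coefficients of absolute value at most $L_n\left(\frac23,\kappa+o(1)\right)$. Let $\alpha$ be a root of $f$ and $K=\mathbb{Q}(\alpha)$. For a maximal ideal $\mathfrak{p}$ of $\mathbb{Z}[\alpha]$ let $e_{\mathfrak{p}}:K^\times\to\mathbb{Z}$ be the homomorphism with $e_{\mathfrak{p}}(x)=\operatorname{length}\left(\mathbb{Z}[\alpha]_{\mathfrak{p}}/x\,\mathbb{Z}[\alpha]_{\mathfrak{p}}\right)$ for $0\ne x\in\mathbb{Z}[\alpha]$. (These $\mathfrak{p}$ correspond to pairs $(r,s)$ of a prime number $r$ and a root $s\in\overline{\mathbb{F}}_r$ of $f \bmod r$, up to conjugacy over $\mathbb{F}_r$, and one writes $e_{r,s}$ for $e_{\mathfrak{p}}$. If $s\in\mathbb{F}_r$ and $a,b$ are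 coprime integers, then $e_{r,s}(a-b\alpha)=\operatorname{ord}_r\left(b^{d}f(a/b)\right)$ when $a\equiv bs \pmod r$, where $d=\deg f$, and $e_{r,s}(a-b\alpha)=0$ otherwise.) Let $$H=\{z\in K^\times: e_{\mathfrak{p}}(z)\text{ is even for every maximal ideal }\mathfrak{p}\text{ of }\mathbb{Z}[\alpha]\}\,/\,\{z^2:z\in K^\times\}.$$ Then $H$ is an $\mathbb{F}_2$-vector space of finite dimension, and as $n\to\infty$ $$\dim_{\mathbb{F}_2}H\le(\delta\kappa+o(1))\log_2 n+\frac{\delta^2\kappa}{2\log 2}\cdot\frac{(\log n)^{4/3}}{(\log\log n)^{1/3}},$$ where the $o(1)$ in the bound depends only on $n$, $\delta$, $\kappa$, the sequence $d(n)$ and the $o(1)$ in the bound for the coefficients, and not on $f$ or $\alpha$. -/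

import Mathlib

open Filter Topology Polynomial
open scoped IntermediateField

/-- `L_n(a, c) = exp (c (log n)^a (log log n)^(1-a))`. -/
noncomputable def subexpL (n : ℕ) (a c : ℝ) : ℝ :=
  Real.exp (c * Real.log n ^ a * Real.log (Real.log n) ^ (1 - a))

namespace NFS

universe u

variable {K : Type u} [Field K]

/-- The subring `ℤ[α]` of `K`. For non-integral `α` it is not contained in the ring of integers. -/
abbrev ZAdjoin (α : K) : Subalgebra ℤ K := Algebra.adjoin ℤ {α}

/-- Evaluation at `α`, as a ring homomorphism `ℤ[X] → ℤ[α]`. -/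
noncomputable def evalHom (α : K) : ℤ[X] →+* ZAdjoin α :=
  (aeval (⟨α, Algebra.self_mem_adjoin_singleton ℤ α⟩ : ZAdjoin α)).toRingHom

theorem coe_evalHom (α : K) (p : ℤ[X]) : (evalHom α p : K) = aeval α p := by
  have := Polynomial.aeval_algHom_apply (ZAdjoin α).val
    (⟨α, Algebra.self_mem_adjoin_singleton ℤ α⟩ : ZAdjoin α) p
  exact this.symm

theorem evalHom_surjective (α : K) : Function.Surjective (evalHom α) := by
  rintro ⟨x, hx⟩
  have hx' : x ∈ Algebra.adjoin ℤ {α} := hx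
  rw [Algebra.adjoin_singleton_eq_range_aeval] at hx'
  obtain ⟨p, rfl⟩ := hx'
  exact ⟨p, Subtype.ext (coe_evalHom α p)⟩

instance isNoetherianRing_zAdjoin (α : K) : IsNoetherianRing (ZAdjoin α) :=
  isNoetherianRing_of_surjective _ _ (evalHom α) (evalHom_surjective α)

instance krullDimLE_zAdjoin [NumberField K] (α : K) : Ring.KrullDimLE 1 (ZAdjoin α) := by
  have halg : IsAlgebraic ℤ α :=
    (IsFractionRing.isAlgebraic_iff ℤ ℚ K).2 (Algebra.IsAlgebraic.isAlgebraic α)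
  obtain ⟨p, hp0, hp⟩ := halg
  have h1 : ringKrullDim (ℤ[X] ⧸ Ideal.span {p}) + 1 ≤ ringKrullDim ℤ[X] :=
    ringKrullDim_quotient_succ_le_of_nonZeroDivisor (mem_nonZeroDivisors_of_ne_zero hp0)
  have h2 : ringKrullDim ℤ[X] = ringKrullDim ℤ + 1 := Polynomial.ringKrullDim_of_isNoetherianRing
  have h3 : ringKrullDim ℤ ≤ 1 := Order.KrullDimLE.krullDim_le (n := 1)
  have h4 : ringKrullDim (ZAdjoin α) ≤ ringKrullDim (ℤ[X] ⧸ Ideal.span {p}) := by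
    refine ringKrullDim_le_of_surjective
      (Ideal.Quotient.lift _ (evalHom α) ?_) ?_
    · intro a ha
      obtain ⟨q, rfl⟩ := Ideal.mem_span_singleton.1 ha
      apply Subtype.ext
      rw [coe_evalHom]
      simp [hp]
    · exact Ideal.Quotient.lift_surjective_of_surjective _ _ (evalHom_surjective α)
  rw [Ring.KrullDimLE, Order.krullDimLE_iff]
  have h5 : ringKrullDim (ZAdjoin α) + 1 ≤ 1 + 1 := by
    calc _ ≤ ringKrullDim (ℤ[X] ⧸ Ideal.span {p}) + 1 := by gcongr
      _ ≤ ringKrullDim ℤ + 1 := h1.trans h2.le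
      _ ≤ 1 + 1 := by gcongr
  exact (ENat.WithBot.add_le_add_one_right_iff).1 h5

instance krullDimLE_localization [NumberField K] (α : K) (P : Ideal (ZAdjoin α)) [P.IsPrime] :
    Ring.KrullDimLE 1 (Localization.AtPrime P) := by
  rw [Ring.KrullDimLE, Order.krullDimLE_iff]
  change ringKrullDim _ ≤ _
  rw [IsLocalization.AtPrime.ringKrullDim_eq_height P (Localization.AtPrime P)]
  exact (Ideal.height_le_ringKrullDim_of_ne_top (Ideal.IsPrime.ne_top')).trans
    (Order.KrullDimLE.krullDim_le (n := 1))

/-- If `K = ℚ(α)`, then `K` is the field of fractions of `ℤ[α]`. -/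
theorem isFractionRing_zAdjoin [NumberField K] (α : K) (hα : ℚ⟮α⟯ = ⊤) :
    IsFractionRing (ZAdjoin α) K := by
  refine IsFractionRing.of_field _ _ fun x => ?_
  have hx : x ∈ ℚ⟮α⟯ := hα ▸ IntermediateField.mem_top
  have hx' : x ∈ (ℚ⟮α⟯).toSubalgebra := hx
  rw [IntermediateField.adjoin_simple_toSubalgebra_of_isAlgebraic
    (Algebra.IsAlgebraic.isAlgebraic α), Algebra.adjoin_singleton_eq_range_aeval] at hx'
  obtain ⟨q, rfl⟩ := hx'
  obtain ⟨b, hb0, hb⟩ := IsLocalization.integerNormalization_spec (nonZeroDivisors ℤ) q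
  have h1 := congrArg (aeval α) hb
  rw [aeval_map_algebraMap, map_zsmul, zsmul_eq_mul, ← coe_evalHom] at h1
  refine ⟨evalHom α (IsLocalization.integerNormalization (nonZeroDivisors ℤ) q), (b : ZAdjoin α), ?_⟩
  have hb' : (b : K) ≠ 0 := Int.cast_ne_zero.2 (nonZeroDivisors.ne_zero hb0)
  change aeval α q = ((evalHom α _ : ZAdjoin α) : K) / ((b : ZAdjoin α) : K)
  rw [h1]
  simp [hb']

variable [NumberField K] (α : K)

/-- The order at a prime `P` of `ℤ[α]`, extended to the multiplicative group of `K = ℚ(α)`: the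
homomorphism `e_P : Kˣ → ℤ` with `e_P x = length (ℤ[α]_P / x ℤ[α]_P)` for nonzero `x ∈ ℤ[α]`.

For a first degree prime `P = (r, α - s)` (with `r` a prime number and `f(s) ≡ 0 mod r`, where `f`
is the minimal polynomial of `α` over `ℤ`) and coprime integers `a`, `b` one has
`e_P (a - b α) = ord_r (b ^ d * f (a / b))` if `a ≡ b s mod r`, and `e_P (a - b α) = 0` if not;
this comes from `ℤ[α] / (a - b α) ≃ ℤ[1 / b] / (f (a / b))`. -/
noncomputable def primeExponent (hα : ℚ⟮α⟯ = ⊤) (P : Ideal (ZAdjoin α)) [P.IsPrime] :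
    Kˣ →* Multiplicative ℤ :=
  haveI := isFractionRing_zAdjoin α hα
  WithZero.unitsWithZeroEquiv.toMonoidHom.comp <| Units.map <| MonoidWithZeroHom.toMonoidHom <|
    (IsLocalization.toLocalizationMap (nonZeroDivisors (ZAdjoin α)) K).lift₀
      ((Ring.ordMonoidWithZeroHom (Localization.AtPrime P)).comp
        (algebraMap (ZAdjoin α) (Localization.AtPrime P)).toMonoidWithZeroHom)
      fun y => Ring.ordMonoidWithZeroHom_isUnit (Localization.AtPrime P)
        ⟨algebraMap _ _ (y : ZAdjoin α), by
          rw [mem_nonZeroDivisors_iff_ne_zero]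
          exact (map_ne_zero_iff _ (IsLocalization.injective (Localization.AtPrime P)
            P.primeCompl_le_nonZeroDivisors)).2 (nonZeroDivisors.ne_zero y.2)⟩

theorem primeExponent_apply (hα : ℚ⟮α⟯ = ⊤) (P : Ideal (ZAdjoin α)) [P.IsPrime]
    (z : Kˣ) (x : ZAdjoin α) (hz : (z : K) = x) (n : ℕ)
    (hn : Module.length (Localization.AtPrime P) (Localization.AtPrime P ⧸
        Ideal.span {algebraMap (ZAdjoin α) (Localization.AtPrime P) x}) = n) :
    (primeExponent α hα P z).toAdd = n := by
  have := isFractionRing_zAdjoin α hα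
  have hx : x ≠ 0 := by
    rintro rfl
    exact z.ne_zero hz
  have hx' : algebraMap (ZAdjoin α) (Localization.AtPrime P) x ∈
      nonZeroDivisors (Localization.AtPrime P) := by
    rw [mem_nonZeroDivisors_iff_ne_zero]
    exact (map_ne_zero_iff _ (IsLocalization.injective (Localization.AtPrime P)
      P.primeCompl_le_nonZeroDivisors)).2 hx
  suffices h : primeExponent α hα P z = Multiplicative.ofAdd (n : ℤ) by rw [h]; rfl
  rw [← WithZero.coe_inj, primeExponent]
  simp only [MonoidHom.comp_apply, MulEquiv.coe_toMonoidHom,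
    WithZero.coe_unitsWithZeroEquiv_eq_units_val, Units.coe_map]
  rw [hz]
  refine (Submonoid.LocalizationMap.lift_eq ..).trans ?_
  exact Ring.ordMonoidWithZeroHom_eq_coe _ hx' hn

/-- The group `V` of all `z ∈ Kˣ` whose order at every maximal ideal of `ℤ[α]` is even. The
maximal ideals of `ℤ[α]` correspond to the pairs `(r, s)` of a prime number `r` and a root `s` of
`f mod r` in an algebraic closure of `𝔽_r`, up to conjugacy over `𝔽_r`. -/
noncomputable def evenSubgroup (hα : ℚ⟮α⟯ = ⊤) : Subgroup Kˣ where
  carrier := {z | ∀ (P : Ideal (ZAdjoin α)) [P.IsMaximal],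
    Even (primeExponent α hα P z).toAdd}
  mul_mem' hx hy P _ := by
    rw [map_mul, toAdd_mul]
    exact (hx P).add (hy P)
  one_mem' P _ := by simp
  inv_mem' hx P _ := by
    rw [map_inv, toAdd_inv]
    exact (hx P).neg

/-- The group `H = V / {z ^ 2 : z ∈ Kˣ}`, written additively. -/
abbrev ObstructionGroup (hα : ℚ⟮α⟯ = ⊤) : Type u :=
  Additive (evenSubgroup α hα ⧸
    (powMonoidHom 2 : Kˣ →* Kˣ).range.subgroupOf (evenSubgroup α hα))

/-- Squares are trivial in `H`, so that `H` is a vector space over `𝔽₂`. -/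
noncomputable instance obstructionGroupModule (hα : ℚ⟮α⟯ = ⊤) :
    Module (ZMod 2) (ObstructionGroup α hα) :=
  AddCommGroup.zmodModule (n := 2) (G := ObstructionGroup α hα) fun x => by
    induction x using Additive.rec with
    | ofMul x =>
      induction x using QuotientGroup.induction_on with
      | H z =>
        rw [← ofMul_pow, ← QuotientGroup.mk_pow, ofMul_eq_zero, QuotientGroup.eq_one_iff]
        exact ⟨z, rfl⟩

end NFS

/-!
The dimension of the obstruction group is compared with invariants of the ring of integers `𝓞 K`.
Let `d` be the degree of `f`, `B` the bound for its coefficients and `m = [K : ℚ] ≤ d`.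

For `j < m` the polynomial formed by the `j + 1` leading coefficients of `f` takes an integral value
at `α`, and all conjugates of this value are at most `(d + 1) B`: where `α` is small this is seen
from the definition, and where it is large from `f(α) = 0`, at archimedean and nonarchimedean places
alike (`norm_aeval_leadingPart_le`, `isIntegral_aeval_leadingPart`). These values form a basis of
`K` inside `ℤ[α]`. Its discriminant `Δ` satisfies `log |Δ| = O(d log B + d ^ 2)`, bounds the
discriminant of `K`, and has `Δ • 𝓞 K ⊆ ℤ[α]` (`exists_discriminant`).

With `D = Δ * f.leadingCoeff`, the rings `ℤ[α]` and `𝓞 K` agree after inverting `D`. So at a prime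
of `𝓞 K` not dividing `D` the order of an element is its length at the prime of `ℤ[α]` below, and is
even for the elements in question (`even_valuation_of_mem_evenSubgroup`). An element of even order
outside the primes dividing `D` is determined up to squares by the parity of its orders at those
primes, by the class of an ideal whose square it generates up to those primes, and by a unit modulo
squares (`relIndex_sq_evenOutside`). Hence the dimension is at most `m ω(D) + log₂ h + m`, with `ω`
the number of prime factors and `h` the class number (`two_pow_finrank_obstructionGroup_le`).

There are at most `m ^ log₂ N` ideals of norm `N` (`ncard_absNorm_eq_le`), so Minkowski's theorem
gives `log h = O(log M * log d)` for a bound `M` of order `2 ^ d * √|Δ|` (`card_classGroup_le`).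
Furthermore `ω(D) ≤ X + log |D| / log X` for every `X > 1` (`card_primeFactors_le`). In the range of
the theorem `d log B` has order `log n`. With `X = √(log n)` all contributions are of smaller order
than `(log n) ^ (4 / 3) / (log log n) ^ (1 / 3)` (`eventually_bound_le`), so the second term of the
bound suffices for large `n`.
-/

/-! ### Counting ideals and ideal classes -/

open NumberField Ideal in
theorem ncard_primesOver_le_finrank (K : Type*) [Field K] [NumberField K] (p : ℕ) [Fact p.Prime] :
    {P : Ideal (𝓞 K) | P.IsPrime ∧ (p : 𝓞 K) ∈ P}.Finite ∧
    {P : Ideal (𝓞 K) | P.IsPrime ∧ (p : 𝓞 K) ∈ P}.ncard ≤ Module.finrank ℚ K := by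
  have hp : Prime (p : ℤ) := Nat.prime_iff_prime_int.1 Fact.out
  have hbot : span {(p : ℤ)} ≠ ⊥ := by simpa using hp.ne_zero
  have : (span {(p : ℤ)}).IsPrime := (span_singleton_prime hp.ne_zero).2 hp
  have : (span {(p : ℤ)}).IsMaximal := IsPrime.isMaximal ‹_› hbot
  have hset : {P : Ideal (𝓞 K) | P.IsPrime ∧ (p : 𝓞 K) ∈ P} =
      (span {(p : ℤ)}).primesOver (𝓞 K) := by
    ext P
    simp only [Set.mem_ofPred_eq, primesOver]
    refine and_congr_right fun hP => ?_
    rw [liesOver_iff]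
    constructor
    · intro h
      refine IsMaximal.eq_of_le ‹_› (IsPrime.ne_top inferInstance) ?_
      rw [span_singleton_le_iff_mem]
      simpa [mem_comap] using h
    · intro h
      have : (p : ℤ) ∈ under ℤ P := h ▸ mem_span_singleton_self _
      simpa [mem_comap] using this
  have hfin := IsDedekindDomain.primesOver_finite (span {(p : ℤ)}) (𝓞 K)
  rw [hset]
  refine ⟨hfin, ?_⟩
  have := hfin.fintype
  rw [← RingOfIntegers.rank, ← sum_ramification_inertia_eq_finrank (span {(p : ℤ)}) (𝓞 K),
    ← Nat.card_coe_set_eq, Nat.card_eq_fintype_card, Fintype.card_eq_sum_ones]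
  refine Finset.sum_le_sum fun q _ => ?_
  have : q.1.IsPrime := q.2.1
  exact Nat.succ_le_of_lt (Nat.mul_pos (ramificationIdx_pos _ _) (inertiaDeg_pos _ _))

open NumberField Ideal in
/-- Peeling off a prime over the least prime factor of `N` costs a factor `[K : ℚ]` and at least
halves the norm. -/
theorem ncard_absNorm_eq_le (K : Type*) [Field K] [NumberField K] (N : ℕ) (hN : N ≠ 0) :
    {I : Ideal (𝓞 K) | absNorm I = N}.ncard ≤ Module.finrank ℚ K ^ Nat.log 2 N := by
  induction N using Nat.strong_induction_on with
  | _ N ih =>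
  have hm : 1 ≤ Module.finrank ℚ K := Module.finrank_pos
  obtain rfl | hN1 := eq_or_ne N 1
  · simp [absNorm_eq_one_iff]
  set p := N.minFac with hp_def
  have : Fact p.Prime := ⟨Nat.minFac_prime hN1⟩
  obtain ⟨hfin, hcard⟩ := ncard_primesOver_le_finrank K p
  set S := {P : Ideal (𝓞 K) | P.IsPrime ∧ (p : 𝓞 K) ∈ P} with hS
  have hN2 : 2 ≤ N := by omega
  have hlog : 1 ≤ Nat.log 2 N := Nat.log_pos (by norm_num) hN2
  -- the condition on `J` is written as a product so that it is empty when `absNorm P ∤ N`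
  have hone : ∀ P ∈ S, ((P * ·) '' {J : Ideal (𝓞 K) | absNorm J * absNorm P = N}).ncard ≤
      Module.finrank ℚ K ^ (Nat.log 2 N - 1) := by
    intro P hP
    have hPne : absNorm P ≠ 1 := by
      rw [Ne, absNorm_eq_one_iff]; exact hP.1.ne_top
    by_cases hdvd : absNorm P ∣ N
    · have hP0 : absNorm P ≠ 0 := fun h => hN (by simpa [h] using hdvd)
      have hlt : N / absNorm P < N := Nat.div_lt_self (by omega) (by omega)
      have hne : N / absNorm P ≠ 0 :=
        (Nat.div_pos (Nat.le_of_dvd (by omega) hdvd) (by omega)).ne'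
      have heq : {J : Ideal (𝓞 K) | absNorm J * absNorm P = N} =
          {J : Ideal (𝓞 K) | absNorm J = N / absNorm P} := by
        ext J
        exact ⟨fun h => (Nat.div_eq_of_eq_mul_left (by omega) (Eq.symm h)).symm,
          fun h => by simp only [Set.mem_ofPred_eq] at h ⊢; rw [h, Nat.div_mul_cancel hdvd]⟩
      rw [heq]
      refine (Set.ncard_image_le (finite_setOfPred_absNorm_eq _)).trans ((ih _ hlt hne).trans ?_)
      refine Nat.pow_le_pow_right hm ?_
      rw [← Nat.log_div_base]
      exact Nat.log_mono_right (Nat.div_le_div_left (by omega) (by norm_num))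
    · have : {J : Ideal (𝓞 K) | absNorm J * absNorm P = N} = ∅ := by
        ext J
        simp only [Set.mem_ofPred_eq, Set.mem_empty_iff_false, iff_false]
        rintro rfl
        exact hdvd (Dvd.intro_left _ rfl)
      simp [this]
  have hsub : {I : Ideal (𝓞 K) | absNorm I = N} ⊆
      ⋃ P ∈ hfin.toFinset, (P * ·) '' {J : Ideal (𝓞 K) | absNorm J * absNorm P = N} := by
    intro I hI
    obtain ⟨P, hPm, hPp, hPI⟩ := exists_isMaximal_dvd_of_dvd_absNorm' (p := p) Fact.out I
      (by rw [Set.mem_ofPred_eq] at hI; rw [hI]; exact Nat.minFac_dvd N)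
    obtain ⟨J, rfl⟩ := hPI
    simp only [Set.mem_iUnion]
    refine ⟨P, ?_, J, ?_, rfl⟩
    · rw [Set.Finite.mem_toFinset]
      refine ⟨hPm.isPrime, ?_⟩
      have : (p : ℤ) ∈ under ℤ P := by rw [hPp]; exact mem_span_singleton_self _
      simpa [mem_comap] using this
    · simp only [Set.mem_ofPred_eq, map_mul] at hI ⊢
      rw [mul_comm, hI]
  calc _ ≤ (⋃ P ∈ hfin.toFinset, (P * ·) '' {J : Ideal (𝓞 K) | absNorm J * absNorm P = N}).ncard :=
        Set.ncard_le_ncard hsub <| Set.Finite.biUnion (Finset.finite_toSet _) fun P hP => by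
          refine Set.Finite.image _ ((finite_setOfPred_absNorm_le N).subset fun J hJ => ?_)
          exact Nat.le_of_dvd (by omega) (Dvd.intro _ hJ)
    _ ≤ ∑ P ∈ hfin.toFinset, ((P * ·) '' {J : Ideal (𝓞 K) | absNorm J * absNorm P = N}).ncard :=
        Finset.set_ncard_biUnion_le _ _
    _ ≤ ∑ P ∈ hfin.toFinset, Module.finrank ℚ K ^ (Nat.log 2 N - 1) :=
        Finset.sum_le_sum fun P hP => hone P (hfin.mem_toFinset.1 hP)
    _ = S.ncard * Module.finrank ℚ K ^ (Nat.log 2 N - 1) := by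
        rw [Finset.sum_const, smul_eq_mul, Set.ncard_eq_toFinset_card S hfin]
    _ ≤ Module.finrank ℚ K * Module.finrank ℚ K ^ (Nat.log 2 N - 1) := Nat.mul_le_mul_right _ hcard
    _ = _ := by rw [← pow_succ', Nat.sub_add_cancel hlog]

open NumberField Ideal in
/-- Every ideal class contains an integral ideal of norm at most the Minkowski bound, so counting
ideals bounds the class number. -/
theorem card_classGroup_le (K : Type*) [Field K] [NumberField K] (M : ℕ)
    (hM : (4 / Real.pi) ^ InfinitePlace.nrComplexPlaces K *
      ((Module.finrank ℚ K).factorial / (Module.finrank ℚ K : ℝ) ^ Module.finrank ℚ K *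
        √|discr K|) ≤ M) :
    Nat.card (ClassGroup (𝓞 K)) ≤ M * Module.finrank ℚ K ^ Nat.log 2 M := by
  have hm : 1 ≤ Module.finrank ℚ K := Module.finrank_pos
  choose I hI hIM using exists_ideal_in_class_of_norm_le (K := K)
  have hfin : (⋃ N ∈ Finset.Icc 1 M, {J : Ideal (𝓞 K) | absNorm J = N}).Finite :=
    Set.Finite.biUnion (Finset.finite_toSet _) fun N _ => finite_setOfPred_absNorm_eq _
  have hinj : Function.Injective fun C => (I C : Ideal (𝓞 K)) := fun C C' h => by
    rw [← hI C, ← hI C', Subtype.ext h]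
  have hmem : Set.range (fun C => (I C : Ideal (𝓞 K))) ⊆
      ⋃ N ∈ Finset.Icc 1 M, {J : Ideal (𝓞 K) | absNorm J = N} := by
    rintro _ ⟨C, rfl⟩
    simp only [Set.mem_iUnion]
    refine ⟨absNorm (I C : Ideal (𝓞 K)), Finset.mem_Icc.2 ⟨?_, ?_⟩, rfl⟩
    · exact Nat.one_le_iff_ne_zero.2 (absNorm_ne_zero_of_nonZeroDivisors _)
    · have := (hIM C).trans (by simpa [mul_assoc] using hM)
      exact_mod_cast this
  calc Nat.card (ClassGroup (𝓞 K)) = (Set.range fun C => (I C : Ideal (𝓞 K))).ncard := by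
        rw [← Nat.card_coe_set_eq, Nat.card_range_of_injective hinj]
    _ ≤ _ := Set.ncard_le_ncard hmem hfin
    _ ≤ ∑ N ∈ Finset.Icc 1 M, {J : Ideal (𝓞 K) | absNorm J = N}.ncard :=
        Finset.set_ncard_biUnion_le _ _
    _ ≤ ∑ N ∈ Finset.Icc 1 M, Module.finrank ℚ K ^ Nat.log 2 M :=
        Finset.sum_le_sum fun N hN => by
          rw [Finset.mem_Icc] at hN
          exact (ncard_absNorm_eq_le K N (by omega)).trans
            (Nat.pow_le_pow_right hm (Nat.log_mono_right hN.2))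
    _ = _ := by simp

/-! ### Units modulo squares -/

/-- A subgroup has index at most `card X` if a map to the finite set `X` separates its cosets. -/
theorem Subgroup.index_le_of_map {G X : Type*} [Group G] [Finite X] (N : Subgroup G) (f : G → X)
    (hf : ∀ x y, f x = f y → x⁻¹ * y ∈ N) : N.index ≠ 0 ∧ N.index ≤ Nat.card X := by
  have hinj : Function.Injective fun q : G ⧸ N => f q.out := fun q q' h => by
    rw [← q.out_eq', ← q'.out_eq']
    exact QuotientGroup.eq.2 (hf _ _ h)
  have : Finite (G ⧸ N) := Finite.of_injective _ hinj
  exact ⟨N.index_ne_zero_of_finite, Nat.card_le_card_of_injective _ hinj⟩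

/-- Powers whose exponents have the same parity differ by a square. -/
theorem zpow_inv_mul_zpow_eq_sq {G : Type*} [Group G] (g : G) {a b : ℤ}
    (h : (a : ZMod 2) = b) : (g ^ a)⁻¹ * g ^ b = (g ^ ((b - a) / 2)) ^ 2 := by
  have h2 : (2 : ℤ) ∣ b - a := by
    exact (ZMod.intCast_eq_intCast_iff_dvd_sub a b 2).1 h
  rw [← zpow_neg, ← zpow_add, ← zpow_natCast (g ^ _), ← zpow_mul]
  congr 1
  push_cast
  omega

open NumberField in
/-- By Dirichlet's unit theorem the units are generated by `r₁ + r₂ ≤ [K : ℚ]` elements. -/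
theorem index_units_sq_le (K : Type*) [Field K] [NumberField K] :
    (powMonoidHom 2 : (𝓞 K)ˣ →* (𝓞 K)ˣ).range.index ≠ 0 ∧
    (powMonoidHom 2 : (𝓞 K)ˣ →* (𝓞 K)ˣ).range.index ≤ 2 ^ Module.finrank ℚ K := by
  obtain ⟨g, hg⟩ := IsCyclic.exists_generator (α := Units.torsion K)
  choose k hk using fun ζ => Subgroup.mem_zpowers_iff.1 (hg ζ)
  choose ζe hζe using fun x => (Units.exist_unique_eq_mul_prod K x).exists
  have key := Subgroup.index_le_of_map (powMonoidHom 2 : (𝓞 K)ˣ →* (𝓞 K)ˣ).range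
    (fun x => ((k (ζe x).1 : ZMod 2), fun i => ((ζe x).2 i : ZMod 2))) fun x y hxy => by
      simp only [Prod.mk.injEq] at hxy
      refine ⟨(g : (𝓞 K)ˣ) ^ ((k (ζe y).1 - k (ζe x).1) / 2) *
        ∏ i, Units.fundSystem K i ^ (((ζe y).2 i - (ζe x).2 i) / 2), ?_⟩
      have h1 : ∀ x, x = (g : (𝓞 K)ˣ) ^ k (ζe x).1 * ∏ i, Units.fundSystem K i ^ (ζe x).2 i :=
        fun x => by
          conv_lhs => rw [hζe x, ← hk (ζe x).1]
          push_cast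
          rfl
      conv_rhs => rw [h1 x, h1 y]
      rw [mul_inv, mul_mul_mul_comm, zpow_inv_mul_zpow_eq_sq _ hxy.1, ← Finset.prod_inv_distrib,
        ← Finset.prod_mul_distrib, powMonoidHom_apply, mul_pow, ← Finset.prod_pow]
      congr 1
      exact Finset.prod_congr rfl fun i _ => (zpow_inv_mul_zpow_eq_sq _ (congrFun hxy.2 i)).symm
  refine ⟨key.1, key.2.trans ?_⟩
  rw [Nat.card_prod, Nat.card_fun, Nat.card_zmod, Nat.card_fin, ← pow_succ']
  refine Nat.pow_le_pow_right (by norm_num) ?_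
  have h1 := InfinitePlace.card_eq_nrRealPlaces_add_nrComplexPlaces (K := K)
  have h2 := InfinitePlace.card_add_two_mul_card_eq_rank K
  have h3 : 1 ≤ Module.finrank ℚ K := Module.finrank_pos
  rw [Units.rank]
  omega

/-! ### Elements of even order outside a finite set of primes -/

namespace NFS

open NumberField IsDedekindDomain

/-- The product of the primes in a finite set `T` that are selected by `t`. -/
noncomputable def selectedProduct {R : Type*} [CommRing R] [IsDedekindDomain R]
    (T : Finset (HeightOneSpectrum R)) (t : T → ZMod 2) : Ideal R :=
  ∏ v : T, (v : HeightOneSpectrum R).asIdeal ^ (t v).val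

open Ideal in
/-- An ideal whose multiplicities outside `T` are even is a square times a product of distinct
primes of `T`. -/
theorem exists_eq_sq_mul_selectedProduct {R : Type*} [CommRing R] [IsDedekindDomain R]
    (T : Finset (HeightOneSpectrum R)) {I : Ideal R} (hI : I ≠ ⊥)
    (hT : ∀ v : HeightOneSpectrum R, v ∉ T → Even (multiplicity v.asIdeal I)) :
    ∃ J : Ideal R, I = J ^ 2 *
      selectedProduct T fun v => (multiplicity v.1.asIdeal I : ZMod 2) := by
  have hfin : (Function.mulSupport fun v : HeightOneSpectrum R =>
      v.asIdeal ^ multiplicity v.asIdeal I).Finite := by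
    have h := Ideal.hasFiniteMulSupport hI
    simp only [HeightOneSpectrum.maxPowDividing_eq_pow_multiplicity hI] at h
    exact h
  have hpos : ∀ v : HeightOneSpectrum R, ∀ k : ℕ, v.asIdeal ^ k ≠ 1 ↔ k ≠ 0 := fun v k => by
    refine ⟨fun h hk => h (by simp [hk]), fun hk h => ?_⟩
    rw [one_eq_top, Ideal.pow_eq_top_iff] at h
    exact h.elim v.isPrime.ne_top hk
  have hfin2 : (Function.mulSupport fun v : HeightOneSpectrum R =>
      v.asIdeal ^ (multiplicity v.asIdeal I / 2)).Finite := by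
    refine hfin.subset fun v hv => ?_
    rw [Function.mem_mulSupport, hpos] at hv ⊢
    omega
  have hfin3 : (Function.mulSupport fun v : HeightOneSpectrum R =>
      v.asIdeal ^ (multiplicity v.asIdeal I % 2)).Finite := by
    refine hfin.subset fun v hv => ?_
    rw [Function.mem_mulSupport, hpos] at hv ⊢
    omega
  refine ⟨∏ᶠ v : HeightOneSpectrum R, v.asIdeal ^ (multiplicity v.asIdeal I / 2), ?_⟩
  conv_lhs => rw [← Ideal.finprod_heightOneSpectrum_pow_multiplicity hI]
  rw [finprod_pow hfin2]
  have h3 : selectedProduct T (fun v => (multiplicity v.1.asIdeal I : ZMod 2)) =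
      ∏ᶠ v : HeightOneSpectrum R, v.asIdeal ^ (multiplicity v.asIdeal I % 2) := by
    rw [finprod_eq_prod_of_mulSupport_subset (s := T), selectedProduct,
      ← Finset.prod_coe_sort T]
    · exact Finset.prod_congr rfl fun v _ => by rw [ZMod.val_natCast]
    · intro v hv
      rw [Function.mem_mulSupport, hpos] at hv
      by_contra hvT
      exact hv (Nat.even_iff.1 (hT v hvT))
  rw [h3, ← finprod_mul_distrib (hfin2.subset fun v hv => ?_) hfin3]
  · refine finprod_congr fun v => ?_
    rw [← pow_mul, ← pow_add, Nat.div_add_mod']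
  · rw [Function.mem_mulSupport] at hv ⊢
    intro h
    exact hv (by rw [h, one_pow])

variable (K : Type*) [Field K] [NumberField K]

/-- The elements of `Kˣ` whose order is even at all primes of the ring of integers outside `T`. -/
noncomputable def evenOutside (T : Finset (HeightOneSpectrum (𝓞 K))) : Subgroup Kˣ where
  carrier := {z | ∀ v ∉ T, Even (v.valuationOfNeZero z).toAdd}
  mul_mem' hx hy v hv := by
    rw [map_mul, toAdd_mul]
    exact (hx v hv).add (hy v hv)
  one_mem' v _ := by simp
  inv_mem' hx v hv := by
    rw [map_inv, toAdd_inv]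
    exact (hx v hv).neg

/-- Up to squares every element of `Kˣ` is a nonzero algebraic integer. -/
theorem exists_integer_mul_sq (z : Kˣ) :
    ∃ b : 𝓞 K, b ≠ 0 ∧ ∃ y : Kˣ, (z : K) * (y : K) ^ 2 = b := by
  obtain ⟨x, y, hy, h⟩ := IsFractionRing.div_surjective (A := 𝓞 K) (z : K)
  have hy0 : (y : K) ≠ 0 := by simpa using nonZeroDivisors.ne_zero hy
  have hx0 : x ≠ 0 := by
    rintro rfl
    exact z.ne_zero (by rw [← h]; simp)
  refine ⟨x * y, mul_ne_zero hx0 (nonZeroDivisors.ne_zero hy), Units.mk0 _ hy0, ?_⟩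
  rw [← h]
  simp only [Units.val_mk0, map_mul]
  field_simp

variable {K}

theorem valuationOfNeZero_eq_neg_multiplicity (v : HeightOneSpectrum (𝓞 K)) (z : Kˣ) {b : 𝓞 K}
    (hb : b ≠ 0) (hz : (z : K) = b) :
    (v.valuationOfNeZero z).toAdd = -(multiplicity v.asIdeal (Ideal.span {b}) : ℤ) := by
  have h : (v.valuationOfNeZero z : WithZero (Multiplicative ℤ)) =
      WithZero.exp (-(multiplicity v.asIdeal (Ideal.span {b}) : ℤ)) := by
    rw [HeightOneSpectrum.valuationOfNeZero_eq, hz]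
    exact (v.valuation_of_algebraMap b).trans (v.intValuation_eq_exp_neg_multiplicity hb)
  exact congrArg Multiplicative.toAdd (WithZero.coe_inj.1 h)

open Ideal nonZeroDivisors in
/-- Classifying an element by the primes of `T` at which its order is odd and by the ideal class of
the square part leaves only units and squares. -/
theorem relIndex_units_sup_sq_evenOutside (T : Finset (HeightOneSpectrum (𝓞 K))) :
    ((Units.map (algebraMap (𝓞 K) K : 𝓞 K →* K)).range ⊔
      (powMonoidHom 2 : Kˣ →* Kˣ).range).relIndex (evenOutside K T) ≠ 0 ∧
    ((Units.map (algebraMap (𝓞 K) K : 𝓞 K →* K)).range ⊔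
      (powMonoidHom 2 : Kˣ →* Kˣ).range).relIndex (evenOutside K T) ≤
      2 ^ T.card * Nat.card (ClassGroup (𝓞 K)) := by
  choose b hb0 y hy using exists_integer_mul_sq K
  have hmult : ∀ z (v : HeightOneSpectrum (𝓞 K)),
      (v.valuationOfNeZero z).toAdd + 2 * (v.valuationOfNeZero (y z)).toAdd =
        -(multiplicity v.asIdeal (Ideal.span {b z}) : ℤ) := fun z v => by
    rw [← valuationOfNeZero_eq_neg_multiplicity v (z * y z ^ 2) (hb0 z) (by simpa using hy z)]
    rw [map_mul, map_pow, toAdd_mul, toAdd_pow]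
    simp
  have hex : ∀ z : evenOutside K T, ∃ J : (Ideal (𝓞 K))⁰, span {b z} = (J : Ideal (𝓞 K)) ^ 2 *
      selectedProduct T fun v => (multiplicity v.1.asIdeal (span {b z}) : ZMod 2) := fun z => by
    have hne : span {b z} ≠ ⊥ := by simpa using hb0 z
    obtain ⟨J, hJ⟩ := exists_eq_sq_mul_selectedProduct T hne fun v hv => by
      have h1 := hmult z v
      have h2 := z.2 v hv
      rw [← Int.even_coe_nat]
      grind
    refine ⟨⟨J, mem_nonZeroDivisors_iff_ne_zero.2 ?_⟩, hJ⟩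
    rintro rfl
    exact hne (by rw [hJ]; simp)
  choose J hJ using hex
  have key := Subgroup.index_le_of_map (((Units.map (algebraMap (𝓞 K) K : 𝓞 K →* K)).range ⊔
      (powMonoidHom 2 : Kˣ →* Kˣ).range).subgroupOf (evenOutside K T))
    (fun z => ((fun v : T => (multiplicity v.1.asIdeal (span {b z}) : ZMod 2)),
      ClassGroup.mk0 (J z))) fun z w h => by
    simp only [Prod.mk.injEq] at h
    obtain ⟨p, q, hp, hq, hpq⟩ := (ClassGroup.mk0_eq_mk0_iff).1 h.2
    have hspan : span {p ^ 2 * b z} = span {q ^ 2 * b w} := by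
      rw [← span_singleton_mul_span_singleton, ← span_singleton_mul_span_singleton,
        ← span_singleton_pow, ← span_singleton_pow, hJ z, hJ w, ← mul_assoc, ← mul_assoc,
        ← mul_pow, ← mul_pow, hpq, h.1]
    obtain ⟨u, hu⟩ := span_singleton_eq_span_singleton.1 hspan
    have hp' : (p : K) ≠ 0 := by simpa using hp
    have hq' : (q : K) ≠ 0 := by simpa using hq
    rw [Subgroup.mem_subgroupOf]
    have huK : (p : K) ^ 2 * ((z : Kˣ) * (y z : K) ^ 2) * (u : 𝓞 K) =
        (q : K) ^ 2 * ((w : Kˣ) * (y w : K) ^ 2) := by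
      rw [hy, hy]
      exact_mod_cast congrArg (algebraMap (𝓞 K) K) hu
    have : ((z⁻¹ * w : evenOutside K T) : Kˣ) = Units.map (algebraMap (𝓞 K) K : 𝓞 K →* K) u *
        (Units.mk0 _ hp' * y z * (Units.mk0 _ hq' * y w)⁻¹) ^ 2 := by
      ext
      have hyw := (y w).ne_zero
      have hz := (z : Kˣ).ne_zero
      push_cast
      simp only [Units.val_mk0, Units.coe_map, MonoidHom.coe_coe]
      field_simp
      linear_combination -huK
    rw [this]
    exact Subgroup.mul_mem_sup ⟨u, rfl⟩ ⟨_, rfl⟩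
  refine ⟨key.1, key.2.trans_eq ?_⟩
  rw [Nat.card_prod, Nat.card_fun, Nat.card_zmod, Nat.card_eq_fintype_card, Fintype.card_coe]

theorem relIndex_sq_evenOutside (T : Finset (HeightOneSpectrum (𝓞 K))) :
    (powMonoidHom 2 : Kˣ →* Kˣ).range.relIndex (evenOutside K T) ≠ 0 ∧
    (powMonoidHom 2 : Kˣ →* Kˣ).range.relIndex (evenOutside K T) ≤
      2 ^ Module.finrank ℚ K * (2 ^ T.card * Nat.card (ClassGroup (𝓞 K))) := by
  obtain ⟨h1, h2⟩ := relIndex_units_sup_sq_evenOutside T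
  set U := (Units.map (algebraMap (𝓞 K) K : 𝓞 K →* K)).range
  set S := (powMonoidHom 2 : Kˣ →* Kˣ).range
  have hle : U ⊔ S ≤ evenOutside K T := by
    refine sup_le ?_ ?_
    · rintro _ ⟨u, rfl⟩ v _
      rw [v.valuation_of_unit_eq u]
      simp
    · rintro _ ⟨z, rfl⟩ v _
      rw [powMonoidHom_apply, map_pow, toAdd_pow]
      simp
  obtain ⟨h3, h4⟩ := index_units_sq_le K
  have h5 : S.relIndex (U ⊔ S) ∣ (powMonoidHom 2 : (𝓞 K)ˣ →* (𝓞 K)ˣ).range.index := by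
    rw [Subgroup.relIndex_sup_right, ← Subgroup.index_comap]
    refine Subgroup.index_dvd_of_le ?_
    rintro _ ⟨u, rfl⟩
    exact ⟨Units.map (algebraMap (𝓞 K) K : 𝓞 K →* K) u, by simp⟩
  rw [← Subgroup.relIndex_mul_relIndex S (U ⊔ S) _ le_sup_right hle]
  exact ⟨mul_ne_zero (ne_zero_of_dvd_ne_zero h3 h5) h1,
    Nat.mul_le_mul ((Nat.le_of_dvd (Nat.pos_of_ne_zero h3) h5).trans h4) h2⟩

end NFS

/-! ### Comparison of `ℤ[α]` with the ring of integers -/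

namespace NFS

open NumberField IsDedekindDomain

variable {K : Type*} [Field K] [NumberField K]

/-- The prime of `ℤ[α]` below a finite place `v` of `K` at which `α` is integral. -/
noncomputable def primeBelow (α : K) (v : HeightOneSpectrum (𝓞 K))
    (hA : ∀ a : ZAdjoin α, v.valuation K (a : K) ≤ 1) : Ideal (ZAdjoin α) where
  carrier := {a | v.valuation K (a : K) < 1}
  add_mem' ha hb := ((v.valuation K).map_add _ _).trans_lt (max_lt ha hb)
  zero_mem' := by simp
  smul_mem' c x hx := by
    change v.valuation K ((c * x : ZAdjoin α) : K) < 1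
    push_cast
    rw [map_mul]
    exact mul_lt_one_of_nonneg_of_lt_one_right (hA c) zero_le hx

section

variable {α : K} {v : HeightOneSpectrum (𝓞 K)} {hA : ∀ a : ZAdjoin α, v.valuation K (a : K) ≤ 1}

theorem mem_primeBelow {a : ZAdjoin α} : a ∈ primeBelow α v hA ↔ v.valuation K (a : K) < 1 :=
  Iff.rfl

theorem notMem_primeBelow {a : ZAdjoin α} : a ∉ primeBelow α v hA ↔ v.valuation K (a : K) = 1 := by
  rw [mem_primeBelow, not_lt]
  exact ⟨fun h => le_antisymm (hA a) h, fun h => h.ge⟩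

instance isPrime_primeBelow : (primeBelow α v hA).IsPrime where
  ne_top' h := by
    have : (1 : ZAdjoin α) ∈ primeBelow α v hA := h ▸ Submodule.mem_top
    simp [mem_primeBelow] at this
  mem_or_mem' {a b} hab := by
    by_contra! h
    rw [notMem_primeBelow, notMem_primeBelow] at h
    rw [mem_primeBelow] at hab
    push_cast at hab
    rw [map_mul, h.1, h.2] at hab
    simp at hab

theorem valuation_le_one_of_integral_multiple (v : HeightOneSpectrum (𝓞 K)) {D : ℤ}
    (hDα : ∃ x : 𝓞 K, (D : K) * α = x) (hvD : v.valuation K (D : K) = 1) (a : ZAdjoin α) :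
    v.valuation K (a : K) ≤ 1 := by
  have hα1 : v.valuation K α ≤ 1 := by
    obtain ⟨x, hx⟩ := hDα
    have h : v.valuation K (x : K) ≤ 1 := v.valuation_le_one x
    rwa [← hx, map_mul, hvD, one_mul] at h
  have hle : ZAdjoin α ≤ subalgebraOfSubring (v.valuation K).valuationSubring.toSubring := by
    refine Algebra.adjoin_le ?_
    rintro _ rfl
    exact hα1
  exact hle a.2

/-- Where `D` is a unit, the local ring of `v` is the localization of `ℤ[α]` at the prime below. -/
theorem exists_mul_eq_of_valuation_le_one {D : ℤ} (hDO : ∀ x : 𝓞 K, (D : K) * x ∈ ZAdjoin α)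
    (hvD : v.valuation K (D : K) = 1) {w : K} (hw : v.valuation K w ≤ 1) :
    ∃ a s : ZAdjoin α, v.valuation K (s : K) = 1 ∧ w * s = a := by
  obtain ⟨n, ⟨d, hd⟩, h⟩ := v.exists_primeCompl_mul_eq_of_integer w hw
  refine ⟨⟨_, hDO n⟩, ⟨_, hDO d⟩, ?_, ?_⟩
  · rw [map_mul, hvD, one_mul]
    exact v.valuation_eq_one_iff_notMem.2 hd
  · change w * ((D : K) * d) = D * n
    change w * (d : K) = n at h
    rw [← h]
    ring

end

variable (α : K) (hα : ℚ⟮α⟯ = ⊤)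

theorem primeExponent_eq_one_of_notMem (P : Ideal (ZAdjoin α)) [P.IsPrime] (z : Kˣ)
    {a : ZAdjoin α} (hz : (z : K) = a) (ha : a ∉ P) : primeExponent α hα P z = 1 := by
  have hu : IsUnit (algebraMap (ZAdjoin α) (Localization.AtPrime P) a) :=
    IsLocalization.map_units (M := P.primeCompl) _ ⟨a, ha⟩
  have := primeExponent_apply α hα P z a hz 0 (by
    rw [Ideal.span_singleton_eq_top.2 hu, Nat.cast_zero, Module.length_eq_zero_iff]
    exact Ideal.Quotient.subsingleton_iff.2 rfl)
  exact congrArg Multiplicative.ofAdd this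

theorem toAdd_primeExponent_eq_one_of_uniformizer (P : Ideal (ZAdjoin α)) [P.IsPrime] (z : Kˣ)
    {a : ZAdjoin α} (hz : (z : K) = a)
    (ha : Ideal.span {algebraMap (ZAdjoin α) (Localization.AtPrime P) a} =
      IsLocalRing.maximalIdeal (Localization.AtPrime P)) :
    (primeExponent α hα P z).toAdd = 1 := by
  refine primeExponent_apply α hα P z a hz 1 ?_
  rw [ha, Nat.cast_one, Module.length_eq_one_iff]
  exact isSimpleModule_iff_isCoatom.2 (IsLocalRing.maximalIdeal.isMaximal _).out

/-- If `ℤ[α]` and the ring of integers agree after inverting `D`, then at a place `v` not dividing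
`D` the localization of `ℤ[α]` at the prime below `v` is the valuation ring of `v`, so that the
length function of `ℤ[α]` there is the order at `v`. -/
theorem even_valuation_of_mem_evenSubgroup {D : ℤ} (hDα : ∃ x : 𝓞 K, (D : K) * α = x)
    (hDO : ∀ x : 𝓞 K, (D : K) * x ∈ ZAdjoin α) (v : HeightOneSpectrum (𝓞 K))
    (hv : (D : 𝓞 K) ∉ v.asIdeal) {z : Kˣ} (hz : z ∈ evenSubgroup α hα) :
    Even (v.valuationOfNeZero z).toAdd := by
  have hvD : v.valuation K (D : K) = 1 := by
    have := (v.valuation_eq_one_iff_notMem (K := K)).2 hv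
    simpa using this
  have hA := valuation_le_one_of_integral_multiple v hDα hvD
  set P := primeBelow α v hA with hP
  obtain ⟨π₀, hπ₀⟩ := v.valuation_exists_uniformizer' K
  set π : ZAdjoin α := ⟨_, hDO π₀⟩ with hπ_def
  have hπ : v.valuation K (π : K) = WithZero.exp (-1) := by
    change v.valuation K ((D : K) * π₀) = _
    rw [map_mul, hvD, one_mul]
    exact hπ₀
  have hπ0 : (π : K) ≠ 0 := by
    intro h
    rw [h, map_zero] at hπ
    exact WithZero.coe_ne_zero hπ.symm
  have hπP : π ∈ P := by
    rw [hP, mem_primeBelow, hπ, ← WithZero.exp_zero, WithZero.exp_lt_exp]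
    norm_num
  have hmax : P.IsMaximal := P.isMaximal_of_isPrime_of_ne_bot fun h => hπ0 (by
    rw [h] at hπP
    simpa using hπP)
  have hspan : Ideal.span {algebraMap (ZAdjoin α) (Localization.AtPrime P) π} =
      IsLocalRing.maximalIdeal (Localization.AtPrime P) := by
    rw [← Localization.AtPrime.map_eq_maximalIdeal]
    refine le_antisymm ?_ ?_
    · rw [Ideal.span_singleton_le_iff_mem]
      exact Ideal.mem_map_of_mem _ hπP
    · rw [Ideal.map_le_iff_le_comap]
      intro y hy
      have hle : v.valuation K ((y : K) / π) ≤ 1 := by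
        rw [map_div₀, hπ]
        rw [hP, mem_primeBelow] at hy
        rw [div_le_one₀ (by simp)]
        obtain h0 | h0 := eq_or_ne (v.valuation K (y : K)) 0
        · rw [h0]
          exact zero_le
        · rw [← WithZero.exp_log h0, ← WithZero.exp_zero, WithZero.exp_lt_exp] at hy
          rw [← WithZero.exp_log h0, WithZero.exp_le_exp]
          omega
      obtain ⟨a, s, hs, h⟩ := exists_mul_eq_of_valuation_le_one hDO hvD hle
      have hsP : s ∉ P := notMem_primeBelow.2 hs
      have hu : IsUnit (algebraMap (ZAdjoin α) (Localization.AtPrime P) s) :=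
        IsLocalization.map_units (M := P.primeCompl) _ ⟨s, hsP⟩
      have hys : y * s = a * π := by
        apply Subtype.ext
        push_cast
        rw [← h]
        field_simp
      rw [Ideal.mem_comap, Ideal.mem_span_singleton, ← hu.dvd_mul_right, ← map_mul, hys, map_mul]
      exact dvd_mul_left _ _
  have h1 := toAdd_primeExponent_eq_one_of_uniformizer α hα P (Units.mk0 _ hπ0) rfl hspan
  set k := (v.valuationOfNeZero z).toAdd with hk
  have hvz : v.valuation K (z : K) = WithZero.exp k := (v.valuationOfNeZero_eq z).symm
  have hu1 : v.valuation K ((z : K) * (π : K) ^ k) = 1 := by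
    rw [map_mul, map_zpow₀, hvz, hπ, ← WithZero.exp_zsmul, ← WithZero.exp_add]
    simp
  obtain ⟨a, s, hs, h⟩ := exists_mul_eq_of_valuation_le_one hDO hvD hu1.le
  have ha : v.valuation K (a : K) = 1 := by rw [← h, map_mul, hu1, hs, one_mul]
  have hs0 : (s : K) ≠ 0 := fun h0 => by rw [h0, map_zero] at hs; exact zero_ne_one hs
  have ha0 : (a : K) ≠ 0 := fun h0 => by rw [h0, map_zero] at ha; exact zero_ne_one ha
  have heq : z * Units.mk0 _ hπ0 ^ k * Units.mk0 _ hs0 = Units.mk0 _ ha0 := by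
    ext
    push_cast
    exact h
  have hexp := congrArg (fun x => (primeExponent α hα P x).toAdd) heq
  simp only [map_mul, map_zpow, toAdd_mul, toAdd_zpow, h1,
    primeExponent_eq_one_of_notMem α hα P (Units.mk0 _ hs0) rfl (notMem_primeBelow.2 hs),
    primeExponent_eq_one_of_notMem α hα P (Units.mk0 _ ha0) rfl (notMem_primeBelow.2 ha),
    toAdd_one] at hexp
  have heven := hz P
  have : (primeExponent α hα P z).toAdd = -k := by
    simpa using eq_neg_of_add_eq_zero_left (by simpa using hexp)
  rw [this] at heven
  exact even_neg.1 heven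

end NFS

/-! ### An integral basis of small discriminant inside `ℤ[α]` -/

namespace NFS

open NumberField IsDedekindDomain

theorem sum_pow_eq_aeval_split {F : Type*} [CommRing F] (f : ℤ[X]) (x : F) {j : ℕ}
    (hj : j ≤ f.natDegree) :
    aeval x f = ∑ i ∈ Finset.range (f.natDegree - j), (f.coeff i : F) * x ^ i +
      x ^ (f.natDegree - j) *
        ∑ i ∈ Finset.range (j + 1), (f.coeff (f.natDegree + i - j) : F) * x ^ i := by
  have h : f.natDegree + 1 = (f.natDegree - j) + (j + 1) := by omega
  rw [aeval_eq_sum_range, h, Finset.sum_range_add, Finset.mul_sum]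
  congr 1
  · exact Finset.sum_congr rfl fun i _ => by rw [zsmul_eq_mul]
  · refine Finset.sum_congr rfl fun i _ => ?_
    rw [zsmul_eq_mul, pow_add, show f.natDegree - j + i = f.natDegree + i - j by omega]
    ring

/-- The polynomial of degree `j` formed by the `j + 1` leading coefficients of `f`. At a root `α` of
`f` these are integral elements of `ℤ[α]`, while for non-monic `f` the powers of `α` need not be. -/
noncomputable def leadingPart (f : ℤ[X]) (j : ℕ) : ℤ[X] :=
  ∑ i ∈ Finset.range (j + 1), C (f.coeff (f.natDegree + i - j)) * X ^ i

theorem aeval_leadingPart {F : Type*} [CommRing F] (f : ℤ[X]) (j : ℕ) (x : F) :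
    aeval x (leadingPart f j) =
      ∑ i ∈ Finset.range (j + 1), (f.coeff (f.natDegree + i - j) : F) * x ^ i := by
  simp [leadingPart]

theorem coeff_leadingPart (f : ℤ[X]) (j : ℕ) : (leadingPart f j).coeff j = f.leadingCoeff := by
  simp [leadingPart, finsetSum_coeff, coeff_X_pow]

theorem degree_leadingPart {f : ℤ[X]} (hf : f ≠ 0) (j : ℕ) : (leadingPart f j).degree = j := by
  refine degree_eq_of_le_of_coeff_ne_zero ?_ ?_
  · refine (degree_sum_le _ _).trans (Finset.sup_le fun i hi => ?_)
    refine (degree_C_mul_X_pow_le _ _).trans ?_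
    exact_mod_cast Nat.lt_succ_iff.1 (Finset.mem_range.1 hi)
  · rw [coeff_leadingPart]
    exact leadingCoeff_ne_zero.2 hf

theorem aeval_leadingPart_mul_pow {F : Type*} [CommRing F] {f : ℤ[X]} {x : F} (hx : aeval x f = 0)
    {j : ℕ} (hj : j ≤ f.natDegree) : x ^ (f.natDegree - j) * aeval x (leadingPart f j) =
      -∑ i ∈ Finset.range (f.natDegree - j), (f.coeff i : F) * x ^ i := by
  rw [aeval_leadingPart]
  have := sum_pow_eq_aeval_split f x hj
  rw [hx] at this
  exact (neg_eq_of_add_eq_zero_right this.symm).symm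

/-- If `|x| ≤ 1`, bound `leadingPart f j` at `x` directly; if `|x| > 1`, express it through negative
powers of `x` by means of `f(x) = 0`. -/
theorem norm_aeval_leadingPart_le {f : ℤ[X]} {x : ℂ} (hx : aeval x f = 0) {B : ℝ}
    (hB : ∀ i, |(f.coeff i : ℝ)| ≤ B) {j : ℕ} (hj : j ≤ f.natDegree) :
    ‖aeval x (leadingPart f j)‖ ≤ (f.natDegree + 1) * B := by
  have hB0 : 0 ≤ B := (abs_nonneg _).trans (hB 0)
  have hc : ∀ i, ‖((f.coeff i : ℤ) : ℂ)‖ ≤ B := fun i => by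
    rw [Complex.norm_intCast]
    exact hB i
  have hjd : (j : ℝ) ≤ f.natDegree := by exact_mod_cast hj
  obtain h1 | h1 := le_or_gt ‖x‖ 1
  · rw [aeval_leadingPart]
    calc _ ≤ ∑ i ∈ Finset.range (j + 1), B := norm_sum_le_of_le _ fun i _ => by
          rw [norm_mul, norm_pow]
          exact (mul_le_of_le_one_right (norm_nonneg _) (pow_le_one₀ (norm_nonneg _) h1)).trans
            (hc _)
      _ = (j + 1) * B := by simp
      _ ≤ _ := by gcongr
  · have hpos : 0 < ‖x‖ ^ (f.natDegree - j) := by positivity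
    refine le_of_mul_le_mul_left ?_ hpos
    rw [← norm_pow, ← norm_mul, aeval_leadingPart_mul_pow hx hj, norm_neg, norm_pow]
    calc _ ≤ ∑ i ∈ Finset.range (f.natDegree - j), B * ‖x‖ ^ (f.natDegree - j) :=
          norm_sum_le_of_le _ fun i hi => by
            rw [norm_mul, norm_pow]
            have := pow_le_pow_right₀ h1.le (Finset.mem_range.1 hi).le
            exact mul_le_mul (hc _) this (by positivity) hB0
      _ = ‖x‖ ^ (f.natDegree - j) * ((f.natDegree - j : ℕ) * B) := by
          simp only [Finset.sum_const, Finset.card_range, nsmul_eq_mul]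
          ring
      _ ≤ _ := by
          have : ((f.natDegree - j : ℕ) : ℝ) ≤ f.natDegree + 1 := by
            rw [Nat.cast_sub hj]
            linarith [(Nat.cast_nonneg j : (0 : ℝ) ≤ j)]
          gcongr

variable {K : Type*} [Field K] [NumberField K] {α : K}

/-- The nonarchimedean counterpart of `norm_aeval_leadingPart_le`. -/
theorem isIntegral_aeval_leadingPart {f : ℤ[X]} (hf : aeval α f = 0) {j : ℕ}
    (hj : j ≤ f.natDegree) : IsIntegral ℤ (aeval α (leadingPart f j)) := by
  suffices h : aeval α (leadingPart f j) ∈ (algebraMap (𝓞 K) K).range by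
    obtain ⟨x, hx⟩ := h
    exact hx ▸ x.2
  refine HeightOneSpectrum.mem_integers_of_valuation_le_one K _ fun v => ?_
  have hc : ∀ i, v.valuation K ((f.coeff i : ℤ) : K) ≤ 1 := fun i => by
    simpa using v.valuation_le_one (K := K) ((f.coeff i : ℤ) : 𝓞 K)
  obtain h1 | h1 := le_or_gt (v.valuation K α) 1
  · rw [aeval_leadingPart]
    refine Valuation.map_sum_le _ fun i _ => ?_
    rw [map_mul, map_pow]
    exact mul_le_one' (hc _) (pow_le_one' h1 _)
  · have hpos : 0 < v.valuation K α ^ (f.natDegree - j) := pow_pos (zero_lt_one.trans h1) _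
    refine le_of_mul_le_mul_left ?_ hpos
    rw [← map_pow, ← map_mul, aeval_leadingPart_mul_pow hf hj, Valuation.map_neg, map_pow, mul_one]
    refine Valuation.map_sum_le _ fun i hi => ?_
    rw [map_mul, map_pow, ← one_mul (v.valuation K α ^ (f.natDegree - j))]
    exact mul_le_mul' (hc _) (pow_le_pow_right₀ h1.le (Finset.mem_range.1 hi).le)

theorem natDegree_minpoly_eq_finrank (hα : ℚ⟮α⟯ = ⊤) :
    (minpoly ℚ α).natDegree = Module.finrank ℚ K :=
  (Field.primitive_element_iff_minpoly_natDegree_eq ℚ α).1 hα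

theorem finrank_le_natDegree (hα : ℚ⟮α⟯ = ⊤) {f : ℤ[X]} (hf0 : f ≠ 0) (hf : aeval α f = 0) :
    Module.finrank ℚ K ≤ f.natDegree := by
  rw [← natDegree_minpoly_eq_finrank hα,
    ← natDegree_map_eq_of_injective (algebraMap ℤ ℚ).injective_int f]
  refine natDegree_le_natDegree (minpoly.degree_le_of_ne_zero _ _ ?_ ?_)
  · exact (Polynomial.map_ne_zero_iff (algebraMap ℤ ℚ).injective_int).2 hf0
  · rw [aeval_map_algebraMap, hf]

theorem linearIndependent_leadingPart (hα : ℚ⟮α⟯ = ⊤) {f : ℤ[X]} (hf0 : f ≠ 0) :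
    LinearIndependent ℚ fun j : Fin (Module.finrank ℚ K) => aeval α (leadingPart f j) := by
  let S : Polynomial.Sequence ℚ :=
    ⟨fun j => (leadingPart f j).map (algebraMap ℤ ℚ), fun j => by
      rw [degree_map_eq_of_injective (algebraMap ℤ ℚ).injective_int, degree_leadingPart hf0]⟩
  have hS : LinearIndependent ℚ fun j : Fin (Module.finrank ℚ K) => S j :=
    S.linearIndependent.comp _ Fin.val_injective
  rw [Fintype.linearIndependent_iff] at hS ⊢
  intro c hc
  refine hS c ?_
  by_contra hne
  have hdeg : (∑ j, c j • S j).degree < Module.finrank ℚ K := by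
    refine (degree_sum_le _ _).trans_lt ?_
    rw [Finset.sup_lt_iff (WithBot.bot_lt_coe _)]
    intro j _
    refine (degree_smul_le _ _).trans_lt ?_
    rw [S.degree_eq]
    exact_mod_cast j.2
  have hroot : aeval α (∑ j, c j • S j) = 0 := by
    rw [map_sum, ← hc]
    refine Finset.sum_congr rfl fun j _ => ?_
    rw [map_smul]
    congr 1
    exact aeval_map_algebraMap ℚ α _
  have := minpoly.degree_le_of_ne_zero ℚ α hne hroot
  rw [degree_eq_natDegree (minpoly.ne_zero (Algebra.IsIntegral.isIntegral α)),
    natDegree_minpoly_eq_finrank hα] at this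
  exact absurd hdeg (not_lt.2 this)

section Discriminant

variable {ι : Type*} [Fintype ι] [DecidableEq ι] (b : Module.Basis ι ℚ K)

theorem exists_intCast_eq_discr (hb : ∀ i, IsIntegral ℤ (b i)) :
    ∃ Δ : ℤ, Δ ≠ 0 ∧ (Δ : ℚ) = Algebra.discr ℚ b := by
  obtain ⟨Δ, hΔ⟩ := IsIntegrallyClosed.isIntegral_iff.1 (Algebra.discr_isIntegral ℚ hb)
  refine ⟨Δ, ?_, hΔ⟩
  rintro rfl
  exact Algebra.discr_not_zero_of_basis ℚ b (by rw [← hΔ]; simp)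

/-- The discriminants differ by the square of the determinant of the integral transition matrix. -/
theorem abs_discr_le_of_integral_basis (hb : ∀ i, IsIntegral ℤ (b i)) :
    |(discr K : ℚ)| ≤ |Algebra.discr ℚ b| := by
  set w := (integralBasis K).reindex ((integralBasis K).indexEquiv b) with hw
  have hdw : Algebra.discr ℚ w = discr K := by
    rw [hw, Module.Basis.coe_reindex, Algebra.discr_reindex, coe_discr]
  have hint : IsIntegral ℤ (w.toMatrix b).det := IsIntegral.det fun i j => by
    rw [hw, Module.Basis.toMatrix_apply, Module.Basis.repr_reindex_apply]
    have h := NumberField.integralBasis_repr_apply K ⟨b j, hb j⟩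
      (((integralBasis K).indexEquiv b).symm i)
    change (integralBasis K).repr (b j) _ = _ at h
    rw [h]
    exact isIntegral_algebraMap
  obtain ⟨r, hr⟩ := IsIntegrallyClosed.isIntegral_iff.1 hint
  have hdisc : Algebra.discr ℚ b = (w.toMatrix b).det ^ 2 * Algebra.discr ℚ w := by
    rw [← Algebra.discr_of_matrix_vecMul, Module.Basis.toMatrix_map_vecMul]
  have hr0 : r ≠ 0 := by
    rintro rfl
    refine Algebra.discr_not_zero_of_basis ℚ b ?_
    rw [hdisc, ← hr]
    simp
  rw [hdisc, hdw, abs_mul, ← hr]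
  refine le_mul_of_one_le_left (abs_nonneg _) ?_
  have : (1 : ℤ) ≤ |r ^ 2| := Int.one_le_abs (pow_ne_zero 2 hr0)
  simpa using (by exact_mod_cast this : (1 : ℚ) ≤ |(r : ℚ) ^ 2|)

/-- The discriminant is a common denominator for the coordinates of all algebraic integers, by
Cramer's rule for the trace matrix. -/
theorem exists_int_repr_discr_smul (hb : ∀ i, IsIntegral ℤ (b i)) {z : K} (hz : IsIntegral ℤ z)
    (i : ι) : ∃ r : ℤ, (r : ℚ) = Algebra.discr ℚ b * b.repr z i := by
  have hcr := Matrix.mulVec_cramer (Algebra.traceMatrix ℚ b) fun i => Algebra.trace ℚ K (z * b i)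
  have hinv : IsUnit (Algebra.traceMatrix ℚ b).det := by
    simpa [← Algebra.discr_def] using Algebra.discr_isUnit_of_basis ℚ b
  rw [← Algebra.traceMatrix_of_basis_mulVec b z, ← Matrix.mulVec_smul] at hcr
  have hcr' := congrArg (Matrix.mulVec (Algebra.traceMatrix ℚ b)⁻¹) hcr
  rw [Matrix.mulVec_mulVec, Matrix.nonsing_inv_mul _ hinv, Matrix.mulVec_mulVec,
    Matrix.nonsing_inv_mul _ hinv, Matrix.one_mulVec, Matrix.one_mulVec] at hcr'
  have hi := congrFun hcr' i
  rw [Algebra.traceMatrix_of_basis_mulVec, Matrix.cramer_apply] at hi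
  refine (IsIntegrallyClosed.isIntegral_iff (R := ℤ) (K := ℚ)).1 ?_
  rw [Algebra.discr_def]
  change IsIntegral ℤ (((Algebra.traceMatrix ℚ b).det • b.equivFun z) i)
  rw [← hi]
  refine IsIntegral.det fun k l => ?_
  rw [Matrix.updateCol_apply]
  split_ifs
  · exact Algebra.isIntegral_trace (hz.mul (hb k))
  · exact Algebra.isIntegral_trace ((hb k).mul (hb l))

theorem abs_discr_le_of_norm_embedding_le {C : ℝ} (hC : ∀ (φ : K →+* ℂ) i, ‖φ (b i)‖ ≤ C) :
    |((Algebra.discr ℚ b : ℚ) : ℝ)| ≤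
      ((Module.finrank ℚ K).factorial * C ^ Module.finrank ℚ K) ^ 2 := by
  have hcard : Fintype.card ι = Module.finrank ℚ K := (Module.finrank_eq_card_basis b).symm
  have hcard' : Fintype.card ι = Fintype.card (K →ₐ[ℚ] ℂ) := by
    rw [hcard, AlgHom.card]
  let e : ι ≃ (K →ₐ[ℚ] ℂ) := Fintype.equivOfCardEq hcard'
  have h := Algebra.discr_eq_det_embeddingsMatrixReindex_pow_two ℚ ℂ b e
  have hdet : ‖(Algebra.embeddingsMatrixReindex ℚ ℂ b e).det‖ ≤
      (Module.finrank ℚ K).factorial * C ^ Module.finrank ℚ K := by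
    have := Matrix.det_le (abv := NormedField.toAbsoluteValue ℂ)
      (A := Algebra.embeddingsMatrixReindex ℚ ℂ b e) (x := C) fun i j => hC (e j).toRingHom i
    rw [hcard, nsmul_eq_mul] at this
    exact this
  have hn := congrArg norm h
  rw [norm_pow, eq_ratCast, Complex.norm_ratCast] at hn
  rw [hn]
  gcongr

end Discriminant

/-- The discriminant `Δ` of the basis of `K` given by the leading parts of `f`. It bounds the
discriminant of `K`, and inverting it makes `ℤ[α]` contain the ring of integers. Its logarithm is at
most of order `d log B + d log d`; for the powers of the integral element `f.leadingCoeff • α` it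
could be of order `d ^ 2 log B`, too much for the bound on the class number. -/
theorem exists_discriminant (hα : ℚ⟮α⟯ = ⊤) {f : ℤ[X]} (hf0 : f ≠ 0) (hf : aeval α f = 0) {B : ℝ}
    (hB : ∀ i, |(f.coeff i : ℝ)| ≤ B) :
    ∃ Δ : ℤ, Δ ≠ 0 ∧ |(discr K : ℝ)| ≤ |(Δ : ℝ)| ∧
      |(Δ : ℝ)| ≤ ((Module.finrank ℚ K).factorial *
        ((f.natDegree + 1) * B) ^ Module.finrank ℚ K) ^ 2 ∧
      ∀ x : 𝓞 K, (Δ : K) * x ∈ ZAdjoin α := by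
  have hle := finrank_le_natDegree hα hf0 hf
  have : Nonempty (Fin (Module.finrank ℚ K)) := ⟨⟨0, Module.finrank_pos⟩⟩
  let b : Module.Basis (Fin (Module.finrank ℚ K)) ℚ K :=
    basisOfLinearIndependentOfCardEqFinrank (linearIndependent_leadingPart hα hf0) (by simp)
  have hb : ∀ j, b j = aeval α (leadingPart f j) := fun j => by simp [b]
  have hint : ∀ j, IsIntegral ℤ (b j) := fun j => by
    rw [hb]
    exact isIntegral_aeval_leadingPart hf (j.2.le.trans hle)
  obtain ⟨Δ, hΔ0, hΔ⟩ := exists_intCast_eq_discr b hint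
  refine ⟨Δ, hΔ0, ?_, ?_, fun x => ?_⟩
  · have := abs_discr_le_of_integral_basis b hint
    rw [← hΔ] at this
    exact_mod_cast this
  · have := abs_discr_le_of_norm_embedding_le b (C := (f.natDegree + 1) * B) fun φ j => by
      rw [hb]
      have hφ : φ (aeval α (leadingPart f j)) = aeval (φ α) (leadingPart f j) :=
        (aeval_algHom_apply φ.toIntAlgHom α _).symm
      rw [hφ]
      refine norm_aeval_leadingPart_le ?_ hB (j.2.le.trans hle)
      have h0 : aeval (φ α) f = φ (aeval α f) := aeval_algHom_apply φ.toIntAlgHom α f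
      rw [h0, hf, map_zero]
    rw [← hΔ] at this
    simpa using this
  · choose r hr using exists_int_repr_discr_smul b hint (RingOfIntegers.isIntegral_coe x)
    have : (Δ : K) * x = ∑ j, (r j : K) * b j := by
      conv_lhs => rw [← b.sum_repr (x : K), Finset.mul_sum]
      refine Finset.sum_congr rfl fun j _ => ?_
      rw [Algebra.smul_def, ← mul_assoc]
      congr 1
      have h := congrArg (algebraMap ℚ K) (hr j)
      rw [← hΔ] at h
      simpa using h.symm
    rw [this]
    refine Subalgebra.sum_mem _ fun j _ => Subalgebra.mul_mem _ (intCast_mem _ _) ?_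
    rw [hb]
    exact aeval_mem_adjoin_singleton ℤ α

end NFS

/-! ### Primes dividing the discriminant -/

/-- Prime factors up to `X` number at most `X`, and the larger ones at most `log N / log X`. -/
theorem card_primeFactors_le {N : ℕ} (hN : N ≠ 0) {X : ℝ} (hX : 1 < X) :
    (N.primeFactors.card : ℝ) ≤ X + Real.log N / Real.log X := by
  have hlogX : 0 < Real.log X := Real.log_pos hX
  rw [← Finset.card_filter_add_card_filter_not (s := N.primeFactors) fun p : ℕ => (p : ℝ) ≤ X]
  push_cast
  refine add_le_add ?_ ?_
  · have hsub : N.primeFactors.filter (fun p : ℕ => (p : ℝ) ≤ X) ⊆ Finset.Icc 1 ⌊X⌋₊ :=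
        fun p hp => by
      rw [Finset.mem_filter] at hp
      exact Finset.mem_Icc.2 ⟨(Nat.prime_of_mem_primeFactors hp.1).one_le, Nat.le_floor hp.2⟩
    have := Finset.card_le_card hsub
    rw [Nat.card_Icc, Nat.add_sub_cancel] at this
    exact (Nat.cast_le.2 this).trans (Nat.floor_le (by linarith))
  · set s := N.primeFactors.filter fun p : ℕ => ¬ (p : ℝ) ≤ X
    rw [le_div_iff₀ hlogX, ← Real.log_pow]
    refine Real.log_le_log (by positivity) ?_
    calc X ^ s.card ≤ ∏ p ∈ s, (p : ℝ) :=
          (Finset.prod_const X).ge.trans <| Finset.prod_le_prod (fun p _ => by linarith)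
            fun p hp => (not_le.1 (Finset.mem_filter.1 hp).2).le
      _ = ((∏ p ∈ s, p : ℕ) : ℝ) := by push_cast; rfl
      _ ≤ N := by
          have h1 : ∏ p ∈ s, p ∣ N :=
            (Finset.prod_dvd_prod_of_subset _ _ _ (Finset.filter_subset _ _)).trans
              (Nat.prod_primeFactors_dvd N)
          exact_mod_cast Nat.le_of_dvd (Nat.pos_of_ne_zero hN) h1

namespace NFS

open NumberField IsDedekindDomain

/-- Every prime containing `D` lies over one of the prime factors of `D`, and at most `[K : ℚ]`
primes lie over each of these. -/
theorem card_heightOneSpectrum_of_intCast_mem (K : Type*) [Field K] [NumberField K] {D : ℤ}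
    (hD : D ≠ 0) :
    ∃ T : Finset (HeightOneSpectrum (𝓞 K)), (∀ v, v ∈ T ↔ (D : 𝓞 K) ∈ v.asIdeal) ∧
      T.card ≤ Module.finrank ℚ K * D.natAbs.primeFactors.card := by
  set U := ⋃ p ∈ D.natAbs.primeFactors, {P : Ideal (𝓞 K) | P.IsPrime ∧ (p : 𝓞 K) ∈ P} with hU
  have hprime : ∀ p ∈ D.natAbs.primeFactors,
      {P : Ideal (𝓞 K) | P.IsPrime ∧ (p : 𝓞 K) ∈ P}.Finite ∧
      {P : Ideal (𝓞 K) | P.IsPrime ∧ (p : 𝓞 K) ∈ P}.ncard ≤ Module.finrank ℚ K := fun p hp => by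
    have : Fact p.Prime := ⟨Nat.prime_of_mem_primeFactors hp⟩
    exact ncard_primesOver_le_finrank K p
  have hUfin : U.Finite := Set.Finite.biUnion (Finset.finite_toSet _) fun p hp => (hprime p hp).1
  have hinj : Function.Injective fun v : HeightOneSpectrum (𝓞 K) => v.asIdeal :=
    fun v w h => HeightOneSpectrum.ext h
  have hsub : (fun v : HeightOneSpectrum (𝓞 K) => v.asIdeal) ''
      {v | (D : 𝓞 K) ∈ v.asIdeal} ⊆ U := by
    rintro _ ⟨v, hv, rfl⟩
    have : NeZero v.asIdeal := ⟨v.ne_bot⟩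
    have hp := Nat.absNorm_under_prime v.asIdeal
    set p := Ideal.absNorm (v.asIdeal.under ℤ) with hp_def
    have hspan : Ideal.span {(p : ℤ)} = v.asIdeal.under ℤ := Int.ideal_span_absNorm_eq_self _
    have hDp : (p : ℤ) ∣ D := by
      rw [← Ideal.mem_span_singleton, hspan, Ideal.mem_comap]
      simpa using hv
    have hpv : (p : 𝓞 K) ∈ v.asIdeal := by
      have : (p : ℤ) ∈ v.asIdeal.under ℤ := hspan ▸ Ideal.mem_span_singleton_self _
      simpa [Ideal.mem_comap] using this
    simp only [hU, Set.mem_iUnion]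
    exact ⟨p, Nat.mem_primeFactors.2 ⟨hp, Int.natCast_dvd.1 hDp, by simpa using hD⟩,
      v.isPrime, hpv⟩
  have hfin : {v : HeightOneSpectrum (𝓞 K) | (D : 𝓞 K) ∈ v.asIdeal}.Finite :=
    (hUfin.subset hsub).of_finite_image hinj.injOn
  refine ⟨hfin.toFinset, fun v => by simp, ?_⟩
  calc hfin.toFinset.card = {v : HeightOneSpectrum (𝓞 K) | (D : 𝓞 K) ∈ v.asIdeal}.ncard :=
        (Set.ncard_eq_toFinset_card _ hfin).symm
    _ = ((fun v : HeightOneSpectrum (𝓞 K) => v.asIdeal) '' {v | (D : 𝓞 K) ∈ v.asIdeal}).ncard :=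
        (Set.ncard_image_of_injective _ hinj).symm
    _ ≤ U.ncard := Set.ncard_le_ncard hsub hUfin
    _ ≤ ∑ p ∈ D.natAbs.primeFactors, {P : Ideal (𝓞 K) | P.IsPrime ∧ (p : 𝓞 K) ∈ P}.ncard :=
        Finset.set_ncard_biUnion_le _ _
    _ ≤ ∑ p ∈ D.natAbs.primeFactors, Module.finrank ℚ K :=
        Finset.sum_le_sum fun p hp => (hprime p hp).2
    _ = _ := by rw [Finset.sum_const, smul_eq_mul, mul_comm]

/-! ### The explicit bound -/

variable {K : Type*} [Field K] [NumberField K] {α : K}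

/-- The obstruction group is counted by the units and the ideal classes of the ring of integers
and by its primes dividing `D`, where nothing is known about the parity of orders. -/
theorem two_pow_finrank_obstructionGroup_le (hα : ℚ⟮α⟯ = ⊤) {D : ℤ} (hD : D ≠ 0)
    (hDα : ∃ x : 𝓞 K, (D : K) * α = x) (hDO : ∀ x : 𝓞 K, (D : K) * x ∈ ZAdjoin α) :
    Module.Finite (ZMod 2) (ObstructionGroup α hα) ∧
    2 ^ Module.finrank (ZMod 2) (ObstructionGroup α hα) ≤
      2 ^ Module.finrank ℚ K * (2 ^ (Module.finrank ℚ K * D.natAbs.primeFactors.card) *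
        Nat.card (ClassGroup (𝓞 K))) := by
  obtain ⟨T, hT, hTcard⟩ := card_heightOneSpectrum_of_intCast_mem K hD
  have hle : evenSubgroup α hα ≤ evenOutside K T := fun z hz v hv =>
    even_valuation_of_mem_evenSubgroup α hα hDα hDO v (fun h => hv ((hT v).2 h)) hz
  obtain ⟨h1, h2⟩ := relIndex_sq_evenOutside T
  have h3 := Subgroup.relIndex_le_of_le_right hle h1
  have h4 : (powMonoidHom 2 : Kˣ →* Kˣ).range.relIndex (evenSubgroup α hα) ≠ 0 :=
    fun h => h1 (Subgroup.relIndex_eq_zero_of_le_right hle h)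
  have hfin : Finite (ObstructionGroup α hα) :=
    Subgroup.index_ne_zero_iff_finite.1 h4
  have hmod : Module.Finite (ZMod 2) (ObstructionGroup α hα) := Module.Finite.of_finite
  refine ⟨hmod, ?_⟩
  have hcard : Nat.card (ObstructionGroup α hα) =
      2 ^ Module.finrank (ZMod 2) (ObstructionGroup α hα) := by
    rw [Module.natCard_eq_pow_finrank (K := ZMod 2), Nat.card_zmod]
  rw [← hcard]
  refine (h3.trans h2).trans ?_
  gcongr
  norm_num

/-- The logarithm of a bound for the Minkowski constant of `K`, in terms of the degree and the
coefficient bound of `f`. -/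
noncomputable def logMinkowski (d : ℕ) (B : ℝ) : ℝ :=
  Real.log (2 ^ (d + 1) * (d.factorial * ((d + 1) * B) ^ d))

/-- An explicit bound for the dimension. The parameter `X` separates the small prime factors of the
discriminant, counted trivially, from the large ones, of which there are few. -/
theorem finrank_obstructionGroup_le (hα : ℚ⟮α⟯ = ⊤) {f : ℤ[X]} (hf0 : f ≠ 0) (hf : aeval α f = 0)
    {B : ℝ} (hB : ∀ i, |(f.coeff i : ℝ)| ≤ B) {X : ℝ} (hX : 1 < X) :
    Module.Finite (ZMod 2) (ObstructionGroup α hα) ∧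
    (Module.finrank (ZMod 2) (ObstructionGroup α hα) : ℝ) ≤
      f.natDegree + f.natDegree * (X + 3 * logMinkowski f.natDegree B / Real.log X) +
        (logMinkowski f.natDegree B + logMinkowski f.natDegree B / Real.log 2 *
          Real.log f.natDegree) / Real.log 2 := by
  set d := f.natDegree with hd
  set m := Module.finrank ℚ K with hm
  have hmd : m ≤ d := finrank_le_natDegree hα hf0 hf
  have hm1 : 1 ≤ m := Module.finrank_pos
  have hlc : f.leadingCoeff ≠ 0 := leadingCoeff_ne_zero.2 hf0
  have hlcB : |(f.leadingCoeff : ℝ)| ≤ B := hB _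
  have hB1 : 1 ≤ B := by
    refine le_trans ?_ hlcB
    exact_mod_cast Int.one_le_abs hlc
  obtain ⟨Δ, hΔ0, hΔK, hΔB, hΔO⟩ := exists_discriminant hα hf0 hf hB
  set G : ℝ := d.factorial * ((d + 1) * B) ^ d with hG
  have hbase : 1 ≤ ((d : ℝ) + 1) * B := by
    have : (0 : ℝ) ≤ d := Nat.cast_nonneg d
    nlinarith
  have hGm : (m.factorial : ℝ) * ((d + 1) * B) ^ m ≤ G :=
    mul_le_mul (by exact_mod_cast Nat.factorial_le hmd) (pow_le_pow_right₀ hbase hmd)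
      (by positivity) (by positivity)
  have hBG : B ≤ G := by
    have h1 : (1 : ℝ) ≤ d.factorial := by exact_mod_cast Nat.factorial_pos d
    have h2 : ((d : ℝ) + 1) * B ≤ ((d + 1) * B) ^ d := le_self_pow₀ hbase (by omega)
    have h3 : B ≤ ((d : ℝ) + 1) * B := by
      have : (0 : ℝ) ≤ d := Nat.cast_nonneg d
      nlinarith
    nlinarith
  have hG1 : 1 ≤ G := hB1.trans hBG
  have hΔG : |(Δ : ℝ)| ≤ G ^ 2 := hΔB.trans (by gcongr)
  set Q := logMinkowski d B with hQ
  have hQG : Real.log G ≤ Q := by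
    refine Real.log_le_log (by linarith) (le_mul_of_one_le_left (by linarith) ?_)
    exact one_le_pow₀ (by norm_num)
  -- the discriminant is at most `G ^ 2`, which bounds the Minkowski constant
  have hMink : (4 / Real.pi) ^ InfinitePlace.nrComplexPlaces K *
      (m.factorial / (m : ℝ) ^ m * √|(discr K : ℝ)|) ≤ 2 ^ d * G := by
    have h1 : (4 / Real.pi) ^ InfinitePlace.nrComplexPlaces K ≤ 2 ^ d := by
      have hle : InfinitePlace.nrComplexPlaces K ≤ d := by
        have := InfinitePlace.card_add_two_mul_card_eq_rank K
        omega
      have hpi : 4 / Real.pi ≤ 2 := by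
        rw [div_le_iff₀ Real.pi_pos]
        linarith [Real.two_le_pi]
      calc _ ≤ (2 : ℝ) ^ InfinitePlace.nrComplexPlaces K := by gcongr
        _ ≤ 2 ^ d := pow_le_pow_right₀ (by norm_num) hle
    have h2 : (m.factorial : ℝ) / (m : ℝ) ^ m ≤ 1 := by
      have : (m.factorial : ℝ) ≤ (m : ℝ) ^ m := by exact_mod_cast Nat.factorial_le_pow m
      exact div_le_one_of_le₀ this (by positivity)
    have h3 : √|(discr K : ℝ)| ≤ G := Real.sqrt_le_iff.2 ⟨by linarith, hΔK.trans hΔG⟩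
    calc _ ≤ (2 : ℝ) ^ d * (1 * G) := by gcongr
      _ = _ := by rw [one_mul]
  set M := ⌈(2 : ℝ) ^ d * G⌉₊ with hM
  have hh := card_classGroup_le K M (hMink.trans (Nat.le_ceil _))
  have h2G : 1 ≤ (2 : ℝ) ^ d * G := one_le_mul_of_one_le_of_one_le (one_le_pow₀ (by norm_num)) hG1
  have hM1 : 1 ≤ M := Nat.one_le_ceil_iff.2 (by linarith)
  have hMQ : Real.log M ≤ Q := by
    refine Real.log_le_log (by exact_mod_cast hM1) ?_
    have := (Nat.ceil_lt_add_one (by linarith : (0 : ℝ) ≤ 2 ^ d * G)).le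
    rw [← hM] at this
    rw [pow_succ]
    linarith
  have hQ0 : 0 ≤ Q := (Real.log_nonneg hG1).trans hQG
  have hlog2 : 0 < Real.log 2 := Real.log_pos (by norm_num)
  have hlogm : Real.log m ≤ Real.log d :=
    Real.log_le_log (by exact_mod_cast hm1) (by exact_mod_cast hmd)
  have hlogm0 : 0 ≤ Real.log m := Real.log_nonneg (by exact_mod_cast hm1)
  have hlogh : Real.log (Nat.card (ClassGroup (𝓞 K))) ≤ Q + Q / Real.log 2 * Real.log d := by
    have hpos : (0 : ℝ) < Nat.card (ClassGroup (𝓞 K)) := by exact_mod_cast Nat.card_pos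
    have hcast : (Nat.card (ClassGroup (𝓞 K)) : ℝ) ≤ M * (m : ℝ) ^ Nat.log 2 M := by
      exact_mod_cast hh
    refine (Real.log_le_log hpos hcast).trans ?_
    rw [Real.log_mul (by positivity) (by positivity), Real.log_pow]
    have hlogM : (Nat.log 2 M : ℝ) ≤ Q / Real.log 2 := by
      rw [le_div_iff₀ hlog2, ← Real.log_pow]
      refine (Real.log_le_log (by positivity) ?_).trans hMQ
      exact_mod_cast Nat.pow_log_le_self 2 (by omega)
    gcongr
  -- inverting the leading coefficient makes `α` integral, and inverting `Δ` puts `𝓞 K` into `ℤ[α]`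
  set D := f.leadingCoeff * Δ with hD
  have hD0 : D ≠ 0 := mul_ne_zero hlc hΔ0
  have hDα : ∃ x : 𝓞 K, (D : K) * α = x := by
    have h1 : IsIntegral ℤ (f.leadingCoeff • α) := isIntegral_leadingCoeff_smul f α hf
    obtain ⟨y, hy⟩ : ∃ y : 𝓞 K, algebraMap (𝓞 K) K y = f.leadingCoeff • α :=
      ⟨⟨_, h1⟩, rfl⟩
    refine ⟨(Δ : 𝓞 K) * y, Eq.trans ?_ (map_mul (algebraMap (𝓞 K) K) _ _).symm⟩
    rw [map_intCast, hy, hD, zsmul_eq_mul]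
    push_cast
    ring
  have hDO : ∀ x : 𝓞 K, (D : K) * x ∈ ZAdjoin α := fun x => by
    have := Subalgebra.mul_mem _ (intCast_mem (ZAdjoin α) f.leadingCoeff) (hΔO x)
    rw [← mul_assoc] at this
    rw [hD]
    push_cast
    exact this
  have hω : (D.natAbs.primeFactors.card : ℝ) ≤ X + 3 * Q / Real.log X := by
    refine (card_primeFactors_le (Int.natAbs_ne_zero.2 hD0) hX).trans ?_
    have hDG : Real.log (D.natAbs : ℕ) ≤ 3 * Q := by
      have h1 : ((D.natAbs : ℕ) : ℝ) ≤ G ^ 3 := by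
        rw [Nat.cast_natAbs, hD]
        push_cast
        rw [abs_mul]
        calc _ ≤ G * G ^ 2 := mul_le_mul (hlcB.trans hBG) hΔG (abs_nonneg _) (by linarith)
          _ = _ := by ring
      refine (Real.log_le_log ?_ h1).trans ?_
      · exact_mod_cast Int.natAbs_pos.2 hD0
      · rw [Real.log_pow]
        push_cast
        linarith
    have := Real.log_pos hX
    gcongr
  obtain ⟨hfinite, hcard⟩ := two_pow_finrank_obstructionGroup_le hα hD0 hDα hDO
  refine ⟨hfinite, ?_⟩
  set r := Module.finrank (ZMod 2) (ObstructionGroup α hα)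
  set w := D.natAbs.primeFactors.card
  have hcard' : (2 : ℝ) ^ r ≤ 2 ^ m * (2 ^ (m * w) * Nat.card (ClassGroup (𝓞 K))) := by
    exact_mod_cast hcard
  have hlog := Real.log_le_log (by positivity) hcard'
  have hpos : (Nat.card (ClassGroup (𝓞 K)) : ℝ) ≠ 0 := by exact_mod_cast Nat.card_pos.ne'
  rw [Real.log_mul (by positivity) (by positivity), Real.log_mul (by positivity) hpos,
    Real.log_pow, Real.log_pow, Real.log_pow] at hlog
  have hr : (r : ℝ) ≤ m + m * w + Real.log (Nat.card (ClassGroup (𝓞 K))) / Real.log 2 := by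
    rw [← sub_le_iff_le_add', le_div_iff₀ hlog2]
    push_cast at hlog
    linarith
  have hmd' : (m : ℝ) ≤ d := by exact_mod_cast hmd
  refine hr.trans ?_
  gcongr

end NFS

/-! ### Asymptotics -/

namespace NFS

theorem logMinkowski_le {d : ℕ} {b : ℝ} :
    logMinkowski d (Real.exp b) ≤ 1 + d + 2 * d ^ 2 + d * b := by
  have hd : (0 : ℝ) ≤ d := Nat.cast_nonneg d
  have h2 : Real.log 2 ≤ 1 := by linarith [Real.log_two_lt_d9]
  have hfac : Real.log d.factorial ≤ d * d := by
    have h1 : (d.factorial : ℝ) ≤ (d : ℝ) ^ d := by exact_mod_cast Nat.factorial_le_pow d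
    refine (Real.log_le_log (by exact_mod_cast Nat.factorial_pos d) h1).trans ?_
    rw [Real.log_pow]
    exact mul_le_mul_of_nonneg_left (Real.log_le_self hd) hd
  have hsucc : Real.log ((d : ℝ) + 1) ≤ d := by
    linarith [Real.log_le_sub_one_of_pos (by positivity : (0 : ℝ) < d + 1)]
  rw [logMinkowski, Real.log_mul (by positivity) (by positivity),
    Real.log_mul (by positivity) (by positivity), Real.log_pow, Real.log_pow,
    Real.log_mul (by positivity) (Real.exp_ne_zero _), Real.log_exp]
  push_cast
  nlinarith

/-- The scale of the degree: `u = (log n / log log n) ^ (1 / 3)`, for which the coefficients have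
logarithm of order `log n / u` and the bound of the theorem is of order `u * log n`. -/
noncomputable def degreeScale (n : ℕ) : ℝ :=
  (Real.log n / Real.log (Real.log n)) ^ (1 / 3 : ℝ)

theorem tendsto_log_natCast : Tendsto (fun n : ℕ => Real.log n) atTop atTop :=
  Real.tendsto_log_atTop.comp tendsto_natCast_atTop_atTop

theorem tendsto_log_log_natCast : Tendsto (fun n : ℕ => Real.log (Real.log n)) atTop atTop :=
  Real.tendsto_log_atTop.comp tendsto_log_natCast

theorem tendsto_log_log_div_degreeScale :
    Tendsto (fun n : ℕ => Real.log (Real.log n) / degreeScale n) atTop (𝓝 0) := by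
  have h : Tendsto (fun x : ℝ => Real.log x ^ (4 / 3 : ℝ) / x ^ (1 / 3 : ℝ)) atTop (𝓝 0) :=
    (isLittleO_log_rpow_rpow_atTop (4 / 3) (by norm_num : (0 : ℝ) < 1 / 3)).tendsto_div_nhds_zero
  refine (h.comp tendsto_log_natCast).congr' ?_
  filter_upwards [tendsto_log_natCast.eventually_gt_atTop 0,
    tendsto_log_log_natCast.eventually_gt_atTop 0] with n hL hl
  simp only [Function.comp_apply, degreeScale]
  rw [Real.div_rpow hL.le hl.le, show (4 / 3 : ℝ) = 1 + 1 / 3 by norm_num, Real.rpow_add hl,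
    Real.rpow_one]
  have h1 := (Real.rpow_pos_of_pos hL (1 / 3)).ne'
  have h2 := (Real.rpow_pos_of_pos hl (1 / 3)).ne'
  field_simp

theorem tendsto_one_div_degreeScale : Tendsto (fun n : ℕ => 1 / degreeScale n) atTop (𝓝 0) := by
  have h := tendsto_log_log_div_degreeScale.mul
    (tendsto_inv_atTop_zero.comp tendsto_log_log_natCast)
  rw [zero_mul] at h
  refine h.congr' ?_
  filter_upwards [tendsto_log_log_natCast.eventually_gt_atTop 0] with n hl
  simp only [Function.comp_apply]
  field_simp

/-- With `X = √(log n)` the bound of `finrank_obstructionGroup_le` is of smaller order than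
`u * log n`: the Minkowski term `Q` is of order `log n`, the primes dividing the discriminant
contribute `u * log n / log log n`, and the class number contributes `log n * log log n`. -/
theorem eventually_bound_le {δ κ C : ℝ} (hδ : 0 < δ) (hκ : 0 < κ) (hC : 0 < C) {d : ℕ → ℕ}
    {c : ℕ → ℝ} (hd : Tendsto (fun n : ℕ => (d n : ℝ) / degreeScale n) atTop (𝓝 δ))
    (hc : Tendsto c atTop (𝓝 κ)) :
    ∀ᶠ n : ℕ in atTop, 1 < √(Real.log n) ∧
      d n + d n * (√(Real.log n) + 3 * logMinkowski (d n) (subexpL n (2 / 3) (c n)) /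
        Real.log √(Real.log n)) + (logMinkowski (d n) (subexpL n (2 / 3) (c n)) +
          logMinkowski (d n) (subexpL n (2 / 3) (c n)) / Real.log 2 * Real.log (d n)) / Real.log 2 ≤
      C * (Real.log n ^ (4 / 3 : ℝ) / Real.log (Real.log n) ^ (1 / 3 : ℝ)) := by
  -- eventually `d n ≤ a * u` and `c n ≤ b`, whence `Q ≤ q * log n`
  set a := δ + 1 with ha
  set b := κ + 1 with hb
  set q := 1 + a + 2 * a ^ 2 + a * b with hq
  have hlim : Tendsto (fun n : ℕ => a * (Real.log n)⁻¹ + a * (√(Real.log n))⁻¹ +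
      6 * a * q * (Real.log (Real.log n))⁻¹ + q / Real.log 2 * (1 / degreeScale n) +
      q / Real.log 2 / Real.log 2 * (Real.log (Real.log n) / degreeScale n)) atTop (𝓝 0) := by
    have h1 := (tendsto_inv_atTop_zero.comp tendsto_log_natCast).const_mul a
    have h2 := (tendsto_inv_atTop_zero.comp
      (Real.tendsto_sqrt_atTop.comp tendsto_log_natCast)).const_mul a
    have h3 := (tendsto_inv_atTop_zero.comp tendsto_log_log_natCast).const_mul (6 * a * q)
    have h4 := tendsto_one_div_degreeScale.const_mul (q / Real.log 2)
    have h5 := tendsto_log_log_div_degreeScale.const_mul (q / Real.log 2 / Real.log 2)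
    have := (((h1.add h2).add h3).add h4).add h5
    simpa using this
  have hLa : Tendsto (fun n : ℕ => Real.log n ^ (2 / 3 : ℝ)) atTop atTop :=
    (tendsto_rpow_atTop (by norm_num)).comp tendsto_log_natCast
  filter_upwards [hlim.eventually_le_const hC, hd.eventually_le_const (by linarith : δ < a),
    hc.eventually_le_const (by linarith : κ < b), hc.eventually_const_lt hκ,
    tendsto_log_natCast.eventually_gt_atTop 1,
    tendsto_log_log_natCast.eventually_ge_atTop 1, hLa.eventually_ge_atTop a]
    with n hn hdn hcn hcn0 hL hl hLan
  set L := Real.log n with hL_def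
  set l := Real.log L with hl_def
  set u := degreeScale n with hu_def
  have hu : u = L ^ (1 / 3 : ℝ) / l ^ (1 / 3 : ℝ) := by
    rw [hu_def, degreeScale, Real.div_rpow (by linarith) (by linarith)]
  have hL0 : 0 < L := by linarith
  have hl0 : 0 < l := by linarith
  have hL3 : 0 < L ^ (1 / 3 : ℝ) := Real.rpow_pos_of_pos hL0 _
  have hl3 : 0 < l ^ (1 / 3 : ℝ) := Real.rpow_pos_of_pos hl0 _
  have hu0 : 0 < u := by rw [hu]; positivity
  have huL3 : u ≤ L ^ (1 / 3 : ℝ) := by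
    rw [hu]
    exact div_le_self hL3.le (Real.one_le_rpow hl (by norm_num))
  have hL13 : L ^ (2 / 3 : ℝ) * L ^ (1 / 3 : ℝ) = L := by
    rw [← Real.rpow_add hL0]
    norm_num
  have hL1 : 1 ≤ L ^ (1 / 3 : ℝ) := Real.one_le_rpow hL.le (by norm_num)
  have hL23 : L ^ (1 / 3 : ℝ) * L ^ (1 / 3 : ℝ) = L ^ (2 / 3 : ℝ) := by
    rw [← Real.rpow_add hL0]
    norm_num
  have hu2 : u ^ 2 ≤ L := by
    calc u ^ 2 ≤ (L ^ (1 / 3 : ℝ)) ^ 2 := by gcongr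
      _ ≤ L := by nlinarith
  have huL : u ≤ L := huL3.trans (by nlinarith)
  have ha0 : 0 < a := by linarith
  have hb0 : 0 < b := by linarith
  have hq0 : 0 < q := by positivity
  have hda : (d n : ℝ) ≤ a * u := (div_le_iff₀ hu0).1 hdn
  have hscale : L ^ (2 / 3 : ℝ) * l ^ (1 - 2 / 3 : ℝ) = L / u := by
    rw [hu, show (1 - 2 / 3 : ℝ) = 1 / 3 by norm_num]
    field_simp
    linarith
  have htarget : L ^ (4 / 3 : ℝ) / l ^ (1 / 3 : ℝ) = L * u := by
    rw [hu, show (4 / 3 : ℝ) = 1 + 1 / 3 by norm_num, Real.rpow_add hL0, Real.rpow_one]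
    ring
  set Q := logMinkowski (d n) (subexpL n (2 / 3) (c n)) with hQ_def
  have hQ : Q ≤ q * L := by
    refine logMinkowski_le.trans ?_
    rw [mul_assoc, hscale]
    have h1 : (d n : ℝ) ^ 2 ≤ a ^ 2 * L := by
      calc (d n : ℝ) ^ 2 ≤ (a * u) ^ 2 := by gcongr
        _ = a ^ 2 * u ^ 2 := by ring
        _ ≤ a ^ 2 * L := by gcongr
    have h2 : (d n : ℝ) * (c n * (L / u)) ≤ a * b * L := by
      calc (d n : ℝ) * (c n * (L / u)) ≤ (a * u) * (b * (L / u)) := by gcongr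
        _ = a * b * L := by field_simp
    have h3 : (d n : ℝ) ≤ a * L := hda.trans (by gcongr)
    rw [hq]
    linarith
  have hlogd : Real.log (d n) ≤ l := by
    obtain h0 | h0 := Nat.eq_zero_or_pos (d n)
    · rw [h0]
      simpa using hl0.le
    · refine Real.log_le_log (by exact_mod_cast h0) ?_
      calc (d n : ℝ) ≤ a * u := hda
        _ ≤ L ^ (2 / 3 : ℝ) * L ^ (1 / 3 : ℝ) := by gcongr
        _ = L := hL13
  have hlogd0 : 0 ≤ Real.log (d n) := Real.log_natCast_nonneg _
  have hsqrt : 1 < √L := Real.lt_sqrt_of_sq_lt (by simpa using hL)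
  have hlogsqrt : Real.log √L = l / 2 := Real.log_sqrt hL0.le
  have hlog2 : 0 < Real.log 2 := Real.log_pos (by norm_num)
  refine ⟨hsqrt, ?_⟩
  rw [htarget, hlogsqrt]
  calc _ ≤ d n + d n * (√L + 3 * (q * L) / (l / 2)) +
        (q * L + q * L / Real.log 2 * l) / Real.log 2 := by gcongr
    _ ≤ a * u + a * u * (√L + 3 * (q * L) / (l / 2)) +
        (q * L + q * L / Real.log 2 * l) / Real.log 2 := by gcongr
    _ = (a * L⁻¹ + a * (√L)⁻¹ + 6 * a * q * l⁻¹ + q / Real.log 2 * (1 / u) +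
          q / Real.log 2 / Real.log 2 * (l / u)) * (L * u) := by
        have hs' : (√L)⁻¹ * L = √L := by
          rw [inv_mul_eq_div]; exact Real.div_sqrt
        have h1 : a * (√L)⁻¹ * (L * u) = a * u * √L := by
          linear_combination a * u * hs'
        simp only [add_mul]
        rw [h1]
        field_simp
        ring
    _ ≤ C * (L * u) := by gcongr

end NFS

theorem mainTheorem11 (δ κ : ℝ) (hδ : 0 < δ) (hκ : 0 < κ) (d : ℕ → ℕ) (c : ℕ → ℝ)
    (hd : Tendsto (fun n : ℕ =>
      (d n : ℝ) / (Real.log n / Real.log (Real.log n)) ^ (1 / 3 : ℝ)) atTop (𝓝 δ))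
    (hc : Tendsto c atTop (𝓝 κ)) :
    ∃ ε : ℕ → ℝ, Tendsto ε atTop (𝓝 0) ∧
      ∀ᶠ n : ℕ in atTop, ∀ f : ℤ[X], Irreducible f → f.natDegree = d n →
        (∀ i, |(f.coeff i : ℝ)| ≤ subexpL n (2 / 3) (c n)) →
        ∀ (K : Type*) [Field K] [NumberField K] (α : K) (hα : ℚ⟮α⟯ = ⊤), aeval α f = 0 →
          Module.Finite (ZMod 2) (NFS.ObstructionGroup α hα) ∧
          (Module.finrank (ZMod 2) (NFS.ObstructionGroup α hα) : ℝ) ≤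
            (δ * κ + ε n) * Real.logb 2 n +
              δ ^ 2 * κ / (2 * Real.log 2) *
                (Real.log n ^ (4 / 3 : ℝ) / Real.log (Real.log n) ^ (1 / 3 : ℝ)) := by
  have hlog2 : 0 < Real.log 2 := Real.log_pos (by norm_num)
  -- the second term alone exceeds the dimension for large `n`, so no error term is needed
  refine ⟨fun _ => 0, tendsto_const_nhds, ?_⟩
  filter_upwards [NFS.eventually_bound_le hδ hκ
    (by positivity : 0 < δ ^ 2 * κ / (2 * Real.log 2)) hd hc, eventually_ge_atTop 1]
    with n hn hn1 f hirr hdeg hB K _ _ α hα hf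
  obtain ⟨hfin, hle⟩ := NFS.finrank_obstructionGroup_le hα hirr.ne_zero hf hB hn.1
  rw [hdeg] at hle
  refine ⟨hfin, (hle.trans hn.2).trans (le_add_of_nonneg_left ?_)⟩
  have : 0 ≤ Real.logb 2 n := Real.logb_nonneg (by norm_num) (by exact_mod_cast hn1)
  positivity
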